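/- Let $\mathbb G$ be an H-type group: the simply connected Lie group of a finite-dimensional two-step stratified real Lie algebra $V_1\oplus V_2$ ($V_2\neq 0$, $[V_1,V_1]=V_2$, $V_2$ central) with inner products on $V_1,V_2$ such that the maps $J_z:V_1\to V_1$ ($z\in V_2$) defined by $\langle J_z u,v\rangle=\langle z,[u,v]\rangle$ satisfy $J_z^2=-|z|^2\,\mathrm{Id}$. Put $m=\dim V_1$, $k=\dim V_2$, $Q=m+2k$, write $x=\exp(v(x)+z(x))$ with $v(x)\in V_1$, $z(x)\in V_2$, and $K(x)=(|v(x)|^4+16|z(x)|^2)^{1/4}$. Let $\nabla_{\mathbb G}=(X_1,\dots,X_m)$, where $X_1,\dots,X_m$ are the left-invariant vector fields generated by an orthonormal basis of $V_1$, and let $dx$ be a Haar measure on $\mathbb G$. Let $\alpha,\gamma\in\mathbb R$. Then for every real-valued $\phi\in C_0^\infty(\mathbb G\setminus\{0\})$, $$\int_{\mathbb G}K^\alpha|\nabla_{\mathbb G}K|^\gamma|\nabla_{\mathbb G}\phi|^2\,dx\;\ge\;\Big(\frac{Q+\alpha-2}{2}\Big)^2\int_{\mathbb G}K^{\alpha-2}|\nabla_{\mathbb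 G}K|^{\gamma+2}\phi^2\,dx ,$$ the integrals being taken in $[0,\infty]$. Moreover, if $Q+\alpha-2>0$ and $\gamma>-m-2$ (that is, the weight on the right-hand side is locally integrable on $\mathbb G\setminus\{0\}$), the constant is sharp: for every $C>\big(\frac{Q+\alpha-2}{2}\big)^2$ there is a real-valued $\phi\in C_0^\infty(\mathbb G\setminus\{0\})$ with $$\int_{\mathbb G}K^\alpha|\nabla_{\mathbb G}K|^\gamma|\nabla_{\mathbb G}\phi|^2\,dx\;<\;C\int_{\mathbb G}K^{\alpha-2}|\nabla_{\mathbb G}K|^{\gamma+2}\phi^2\,dx .$$ -/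

import Mathlib

open MeasureTheory
open scoped ENNReal ContDiff

/-- A stratified two-step real Lie algebra `V₁ ⊕ V₂` (here `V` is the first layer `V₁` and `Z` the
second layer `V₂ ≠ 0`), both layers being finite-dimensional inner product spaces. The Lie bracket
is `[(u, z), (u', z')] = (0, bracket u u')`; it is alternating, the second layer is central (so the
Jacobi identity is automatic), and `[V₁, V₁] = V₂`. -/
structure TwoStepAlgebra (V Z : Type*) [NormedAddCommGroup V] [InnerProductSpace ℝ V]
    [NormedAddCommGroup Z] [InnerProductSpace ℝ Z] where
  bracket : V →ₗ[ℝ] V →ₗ[ℝ] Z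
  bracket_self : ∀ u : V, bracket u u = 0
  span_bracket : Submodule.span ℝ {z : Z | ∃ u v : V, bracket u v = z} = ⊤
  nontrivial_snd : Nontrivial Z

namespace TwoStepAlgebra

section

variable {V Z : Type*} [NormedAddCommGroup V] [InnerProductSpace ℝ V]
  [NormedAddCommGroup Z] [InnerProductSpace ℝ Z]

/-- The map `J : V₂ → End V₁` determined by `⟨J_z u, v⟩ = ⟨z, [u, v]⟩`
(see `TwoStepAlgebra.inner_J`). -/
noncomputable def J [FiniteDimensional ℝ V] [FiniteDimensional ℝ Z] (L : TwoStepAlgebra V Z) :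
    Z →ₗ[ℝ] Module.End ℝ V :=
  LinearMap.mk₂ ℝ (fun z u => LinearMap.adjoint (L.bracket u) z)
    (fun z z' u => by simp) (fun c z u => by simp)
    (fun z u u' => by simp) (fun c z u => by simp)

theorem inner_J [FiniteDimensional ℝ V] [FiniteDimensional ℝ Z] (L : TwoStepAlgebra V Z)
    (z : Z) (u v : V) : inner ℝ (L.J z u) v = inner ℝ z (L.bracket u v) := by
  simp [J, LinearMap.adjoint_inner_left]

/-- The algebra is of H-type (Heisenberg type): `J_z² = -‖z‖² Id` for all `z ∈ V₂`. -/
def IsHType [FiniteDimensional ℝ V] [FiniteDimensional ℝ Z] (L : TwoStepAlgebra V Z) : Prop :=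
  ∀ z : Z, L.J z * L.J z = -(‖z‖ ^ 2 • (1 : Module.End ℝ V))

/-- The connected, simply connected Lie group with Lie algebra `L`, in exponential coordinates:
the point `x = exp (v + z)`, `v ∈ V₁`, `z ∈ V₂`, is the pair `(v, z)`. -/
def Grp (_ : TwoStepAlgebra V Z) : Type _ := V × Z

variable (L : TwoStepAlgebra V Z)

/- The linear structure, topology and Borel sets of the coordinate space `V₁ × V₂`. The particular
norm on the product plays no role below; it only gives the topology and the notion of smoothness. -/
noncomputable instance : NormedAddCommGroup L.Grp := inferInstanceAs (NormedAddCommGroup (V × Z))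

noncomputable instance : NormedSpace ℝ L.Grp := inferInstanceAs (NormedSpace ℝ (V × Z))

noncomputable instance : MeasurableSpace L.Grp := borel L.Grp

noncomputable instance : BorelSpace L.Grp := ⟨rfl⟩

/-- The exponential map `V₁ ⊕ V₂ → G`. -/
def exp (v : V) (z : Z) : L.Grp := (v, z)

/-- The coordinate map `v : G → V₁`. -/
def vCoord (x : L.Grp) : V := Prod.fst x

/-- The coordinate map `z : G → V₂`. -/
def zCoord (x : L.Grp) : Z := Prod.snd x

@[ext] theorem Grp.ext {x y : L.Grp} (hv : L.vCoord x = L.vCoord y)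
    (hz : L.zCoord x = L.zCoord y) : x = y := Prod.ext hv hz

/-- The group law given by the Baker-Campbell-Hausdorff formula
`exp a * exp b = exp (a + b + ½ [a, b])`. -/
noncomputable instance : Mul L.Grp :=
  ⟨fun x y => L.exp (L.vCoord x + L.vCoord y)
    (L.zCoord x + L.zCoord y + (1 / 2 : ℝ) • L.bracket (L.vCoord x) (L.vCoord y))⟩

noncomputable instance : One L.Grp := ⟨L.exp 0 0⟩

noncomputable instance : Inv L.Grp := ⟨fun x => L.exp (-L.vCoord x) (-L.zCoord x)⟩

@[simp] theorem vCoord_exp (v : V) (z : Z) : L.vCoord (L.exp v z) = v := rfl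
@[simp] theorem zCoord_exp (v : V) (z : Z) : L.zCoord (L.exp v z) = z := rfl
@[simp] theorem vCoord_mul (x y : L.Grp) : L.vCoord (x * y) = L.vCoord x + L.vCoord y := rfl
@[simp] theorem zCoord_mul (x y : L.Grp) : L.zCoord (x * y) =
    L.zCoord x + L.zCoord y + (1 / 2 : ℝ) • L.bracket (L.vCoord x) (L.vCoord y) := rfl
@[simp] theorem vCoord_one : L.vCoord (1 : L.Grp) = 0 := rfl
@[simp] theorem zCoord_one : L.zCoord (1 : L.Grp) = 0 := rfl
@[simp] theorem vCoord_inv (x : L.Grp) : L.vCoord x⁻¹ = -L.vCoord x := rfl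
@[simp] theorem zCoord_inv (x : L.Grp) : L.zCoord x⁻¹ = -L.zCoord x := rfl

noncomputable instance : Group L.Grp :=
  Group.ofLeftAxioms
    (fun x y z => by
      ext
      · simp [add_assoc]
      · simp only [zCoord_mul, vCoord_mul, map_add, LinearMap.add_apply, smul_add]
        abel)
    (fun x => by ext <;> simp)
    (fun x => by ext <;> simp [L.bracket_self])

/-- The derivative of `f` at `x` along the left-invariant vector field generated by `u ∈ V₁`:
`d/dt f (x * exp (t u))` at `t = 0`. -/
noncomputable def leftInvDeriv (u : V) (f : L.Grp → ℝ) (x : L.Grp) : ℝ :=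
  deriv (fun t : ℝ => f (x * L.exp (t • u) 0)) 0

/-- The horizontal gradient `∇_G f = (X₁ f, …, X_m f)`, where `X₁, …, X_m` are the left-invariant
vector fields generated by an orthonormal basis `b` of `V₁`. -/
noncomputable def hGrad {m : ℕ} (b : OrthonormalBasis (Fin m) ℝ V) (f : L.Grp → ℝ) (x : L.Grp) :
    EuclideanSpace ℝ (Fin m) :=
  WithLp.toLp 2 fun i => L.leftInvDeriv (b i) f x

/-- The homogeneous norm `K(x) = (|v(x)|⁴ + 16 |z(x)|²)^{1/4}`. -/
noncomputable def K (x : L.Grp) : ℝ :=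
  (‖L.vCoord x‖ ^ 4 + 16 * ‖L.zCoord x‖ ^ 2) ^ (1 / 4 : ℝ)

/-- Real-valued test functions: `φ ∈ C₀^∞(G \ {0})`, with `0` the identity of the group. -/
def IsTestFunction (φ : L.Grp → ℝ) : Prop :=
  ContDiff ℝ ∞ φ ∧ HasCompactSupport φ ∧ (1 : L.Grp) ∉ tsupport φ

/-- `∫_G K^α |∇_G K|^γ |∇_G φ|² dμ`, with values in `[0, ∞]`. -/
noncomputable def gradIntegral {m : ℕ} (b : OrthonormalBasis (Fin m) ℝ V) (μ : Measure L.Grp)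
    (α γ : ℝ) (φ : L.Grp → ℝ) : ℝ≥0∞ :=
  ∫⁻ x, ENNReal.ofReal (L.K x ^ α * ‖L.hGrad b L.K x‖ ^ γ * ‖L.hGrad b φ x‖ ^ 2) ∂μ

/-- `∫_G K^{α-2} |∇_G K|^{γ+2} φ² dμ`, with values in `[0, ∞]`. -/
noncomputable def hardyIntegral {m : ℕ} (b : OrthonormalBasis (Fin m) ℝ V) (μ : Measure L.Grp)
    (α γ : ℝ) (φ : L.Grp → ℝ) : ℝ≥0∞ :=
  ∫⁻ x, ENNReal.ofReal (L.K x ^ (α - 2) * ‖L.hGrad b L.K x‖ ^ (γ + 2) * φ x ^ 2) ∂μ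

end

end TwoStepAlgebra

/-!
On `{v ≠ 0}` consider the vector field `R = v·∂_v + 2 z·∂_z + 4 ‖v‖⁻² (J_z v)·∂_v`, the generator of
the dilations plus a rotation of the first layer. It is, up to a positive factor, the horizontal
field `∇_G K`: the horizontal direction `u = ‖v‖² v + 4 J_z v = K³ ∇_G K` satisfies
`[v, u] = 4 ‖v‖² z` in an H-type algebra, so the left-invariant derivative along `u` is `‖v‖² R`.
Since `‖u‖ = ‖v‖ K²`, this gives `|∇_G K| = ‖v‖ / K` and, by Cauchy-Schwarz,
`|∇_G φ| ≥ (‖v‖ / K²) |R φ|` (`TwoStepAlgebra.IsHType.norm_mul_abs_fderiv_flowField_le`), so it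
suffices to prove
`∫ w (R φ)² ≥ (a/2)² ∫ w φ²` with `w = K^{α-2} |∇_G K|^{γ+2}` and `a = Q + α - 2`.

The flow of `R` is explicit: at time `t` it is the dilation by `e^t` composed with
`(v, z) ↦ (exp (4 t ‖v‖⁻² J_z) v, z)`. For fixed `z` the latter rotates each sphere `‖v‖ = r` by an
isometry depending on `r` only, hence preserves Lebesgue measure
(`measurePreserving_radial_isometry`), and the flow multiplies Lebesgue measure by `e^{Qt}`. As it
also satisfies `K ↦ e^t K` and leaves `|∇_G K|` invariant, averaging over the flow
(`TwoStepAlgebra.IsHType.lintegral_eq_lintegral_orbits`) turns both integrals into integrals over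
the shell `1 ≤ K < e` of one-dimensional integrals `∫ e^{at} f'(t)² dt` and `∫ e^{at} f(t)² dt`, where
`f(t)` is `φ` along an orbit. In one dimension, with `g = e^{at/2} f`,
`∫ e^{at} f'² = ∫ g'² + (a/2)² ∫ g²` (`integral_exp_mul_deriv_sq`). Nothing is required of the
weight on the null set `{v = 0}`, which is why all exponents `γ` are allowed.

For `φ = f (log K)` the pointwise inequality is an equality, and both integrals are the
one-dimensional ones times the mass of `K^{-a} w` on the shell, which is positive, and finite when
`γ + 2 > -m`. Sharpness thus reduces to the line, where `g(t) = χ(ε t)` makes `∫ g'²` negligible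
against `∫ g²`.
-/

/-! ### Radial isometries and Lebesgue measure -/

/-- Linear isometries preserve the surface measure of the unit sphere. -/
theorem lintegral_toSphere_comp_linearIsometryEquiv {E : Type*} [NormedAddCommGroup E]
    [InnerProductSpace ℝ E] [FiniteDimensional ℝ E] [MeasurableSpace E] [BorelSpace E]
    (U : E ≃ₗᵢ[ℝ] E) (f : E → ℝ≥0∞) (hf : Measurable f) :
    ∫⁻ ξ, f (U (ξ : E)) ∂(volume : Measure E).toSphere
      = ∫⁻ ξ, f (ξ : E) ∂(volume : Measure E).toSphere := by
  let S : Metric.sphere (0 : E) 1 → Metric.sphere (0 : E) 1 :=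
    fun ξ => ⟨U ξ, by simp⟩
  have hS : Continuous S := by
    apply Continuous.subtype_mk
    exact U.continuous.comp continuous_subtype_val
  have hmp : MeasurePreserving S (volume : Measure E).toSphere (volume : Measure E).toSphere := by
    refine ⟨hS.measurable, ?_⟩
    ext s hs
    rw [Measure.map_apply hS.measurable hs, Measure.toSphere_apply' _ hs,
      Measure.toSphere_apply' _ (hS.measurable hs)]
    congr 1
    refine Eq.trans ?_ (U.measurePreserving.measure_preimage_emb
      U.toHomeomorph.measurableEmbedding _)
    congr 1
    ext x
    simp only [Set.mem_smul, Set.mem_image, Set.mem_preimage, Subtype.exists, exists_and_right,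
      exists_eq_right]
    constructor
    · rintro ⟨r, hr, y, ⟨hy, hys⟩, rfl⟩
      exact ⟨r, hr, U y, ⟨by simpa using hy, hys⟩, (U.map_smul r y).symm⟩
    · rintro ⟨r, hr, y, ⟨hy, hys⟩, h⟩
      refine ⟨r, hr, U.symm y, ⟨by simpa using hy, ?_⟩, ?_⟩
      · simpa [S] using hys
      · apply U.injective
        rw [U.map_smul, U.apply_symm_apply]
        exact h
  exact hmp.lintegral_comp (f := fun ξ => f (ξ : E)) (hf.comp measurable_subtype_coe)

/-- Polar coordinates for the Lebesgue integral. -/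
theorem lintegral_eq_lintegral_polar {E : Type*} [NormedAddCommGroup E] [Nontrivial E]
    [InnerProductSpace ℝ E] [FiniteDimensional ℝ E] [MeasurableSpace E] [BorelSpace E]
    (f : E → ℝ≥0∞) (hf : Measurable f) :
    ∫⁻ x, f x = ∫⁻ r : Set.Ioi (0 : ℝ), ∫⁻ ξ, f ((r : ℝ) • (ξ : E))
      ∂(volume : Measure E).toSphere ∂(Measure.volumeIoiPow (Module.finrank ℝ E - 1)) := by
  have hmp := (volume : Measure E).measurePreserving_homeomorphUnitSphereProd
  have h1 : ∫⁻ x, f x = ∫⁻ x : ({0}ᶜ : Set E), f x ∂((volume : Measure E).comap (↑)) := by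
    rw [lintegral_subtype_comap (measurableSet_singleton _).compl]
    rw [restrict_compl_singleton]
  have hm : Measurable fun p : Metric.sphere (0 : E) 1 × Set.Ioi (0 : ℝ) =>
      f ((p.2 : ℝ) • (p.1 : E)) := by
    apply hf.comp
    fun_prop
  rw [h1, ← lintegral_prod_symm _ hm.aemeasurable, ← hmp.lintegral_comp hm]
  refine lintegral_congr fun x => ?_
  congr 1
  have hx : ‖(x : E)‖ ≠ 0 := norm_ne_zero_iff.2 x.2
  simp [smul_smul, hx]

/-- Rotating every sphere about the origin by an isometry that depends only on its radius preserves
the Lebesgue measure. -/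
theorem measurePreserving_radial_isometry {E : Type*} [NormedAddCommGroup E] [Nontrivial E]
    [InnerProductSpace ℝ E] [FiniteDimensional ℝ E] [MeasurableSpace E] [BorelSpace E]
    (U : ℝ → E ≃ₗᵢ[ℝ] E) (hU : Measurable fun x : E => U ‖x‖ x) :
    MeasurePreserving (fun x : E => U ‖x‖ x) volume volume := by
  refine ⟨hU, Measure.ext_of_lintegral _ fun f hf => ?_⟩
  rw [lintegral_map hf hU, lintegral_eq_lintegral_polar f hf,
    lintegral_eq_lintegral_polar (fun x => f (U ‖x‖ x)) (hf.comp hU)]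
  refine lintegral_congr fun r => ?_
  have hr : 0 < (r : ℝ) := r.2
  rw [← lintegral_toSphere_comp_linearIsometryEquiv (U r) (fun x => f ((r : ℝ) • x))
    (hf.comp (measurable_const_smul _))]
  refine lintegral_congr fun ξ => ?_
  have : ‖(r : ℝ) • (ξ : E)‖ = r := by
    rw [norm_smul, norm_eq_of_mem_sphere, mul_one, Real.norm_of_nonneg hr.le]
  simp [this]

/-! ### The flow of the radial field -/

namespace TwoStepAlgebra

variable {V Z : Type*} [NormedAddCommGroup V] [InnerProductSpace ℝ V] [FiniteDimensional ℝ V]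
  [NormedAddCommGroup Z] [InnerProductSpace ℝ Z] [FiniteDimensional ℝ Z] (L : TwoStepAlgebra V Z)

theorem nontrivial_fst {V Z : Type*} [NormedAddCommGroup V] [InnerProductSpace ℝ V]
    [NormedAddCommGroup Z] [InnerProductSpace ℝ Z] (L : TwoStepAlgebra V Z) : Nontrivial V := by
  by_contra h
  rw [not_nontrivial_iff_subsingleton] at h
  have h0 : {z : Z | ∃ u v : V, L.bracket u v = z} ⊆ {0} := by
    rintro _ ⟨u, v, rfl⟩
    simp [Subsingleton.elim u 0]
  have := L.nontrivial_snd
  have h1 : (⊤ : Submodule ℝ Z) ≤ ⊥ := by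
    rw [← L.span_bracket, Submodule.span_le]
    exact h0
  exact top_ne_bot (le_bot_iff.1 h1)

theorem bracket_swap {V Z : Type*} [NormedAddCommGroup V] [InnerProductSpace ℝ V]
    [NormedAddCommGroup Z] [InnerProductSpace ℝ Z] (L : TwoStepAlgebra V Z) (u v : V) :
    L.bracket u v = -L.bracket v u := by
  have h := L.bracket_self (u + v)
  simp only [map_add, LinearMap.add_apply, L.bracket_self, zero_add, add_zero] at h
  exact eq_neg_of_add_eq_zero_right h

theorem continuous_bracket {V Z : Type*} [NormedAddCommGroup V] [InnerProductSpace ℝ V]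
    [FiniteDimensional ℝ V] [NormedAddCommGroup Z] [InnerProductSpace ℝ Z]
    (L : TwoStepAlgebra V Z) {X : Type*} [TopologicalSpace X] {f g : X → V}
    (hf : Continuous f) (hg : Continuous g) : Continuous fun x => L.bracket (f x) (g x) :=
  (L.bracket.toContinuousBilinearMap.continuous.comp hf).clm_apply hg

theorem continuous_J {X : Type*} [TopologicalSpace X] {f : X → Z} {g : X → V}
    (hf : Continuous f) (hg : Continuous g) : Continuous fun x => L.J (f x) (g x) :=
  ((LinearMap.toContinuousBilinearMap (𝕜 := ℝ) (E := Z) (F := V) (G := V)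
    L.J).continuous.comp hf).clm_apply hg

theorem inner_J_self (z : Z) (v : V) : inner ℝ (L.J z v) v = 0 := by
  simp [L.inner_J, L.bracket_self]

variable {L}

theorem IsHType.J_J (hL : L.IsHType) (z : Z) (v : V) : L.J z (L.J z v) = -(‖z‖ ^ 2 • v) := by
  simpa using LinearMap.congr_fun (hL z) v

theorem IsHType.norm_J (hL : L.IsHType) (z : Z) (v : V) : ‖L.J z v‖ = ‖z‖ * ‖v‖ := by
  rw [← sq_eq_sq₀ (by positivity) (by positivity), ← real_inner_self_eq_norm_sq, L.inner_J,
    L.bracket_swap, inner_neg_right, ← L.inner_J, hL.J_J, inner_neg_left, inner_smul_left,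
    real_inner_self_eq_norm_sq]
  simp [mul_pow]

theorem IsHType.inner_J_J (hL : L.IsHType) (z w : Z) (v : V) :
    inner ℝ (L.J z v) (L.J w v) = ‖v‖ ^ 2 * inner ℝ z w := by
  rw [real_inner_eq_norm_add_mul_self_sub_norm_mul_self_sub_norm_mul_self_div_two,
    real_inner_eq_norm_add_mul_self_sub_norm_mul_self_sub_norm_mul_self_div_two z w,
    ← LinearMap.add_apply, ← map_add, hL.norm_J, hL.norm_J, hL.norm_J]
  ring

theorem IsHType.bracket_J (hL : L.IsHType) (z : Z) (v : V) :
    L.bracket v (L.J z v) = ‖v‖ ^ 2 • z := by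
  refine ext_inner_left ℝ fun w => ?_
  rw [← L.inner_J, hL.inner_J_J, inner_smul_right]

variable (L)

/-- The rotation `exp (s J_z)` of the first layer. Since `J_z² = -‖z‖² Id`, it equals
`cos (s‖z‖) Id + (sin (s‖z‖) / ‖z‖) J_z`; for `z = 0` the second term vanishes with `J_0`. -/
noncomputable def rot (s : ℝ) (z : Z) (v : V) : V :=
  Real.cos (s * ‖z‖) • v + (Real.sin (s * ‖z‖) / ‖z‖) • L.J z v

/-- The flow of the vector field
`R = v·∂_v + 2 z·∂_z + 4 ‖v‖⁻² (J_z v)·∂_v` on `{v ≠ 0}`. The quotient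
`‖z‖ / ‖v‖²` is constant along orbits, so the rotation has constant speed.
On the null set `{v = 0}` the division by zero makes it the plain dilation. -/
noncomputable def flow (t : ℝ) (p : V × Z) : V × Z :=
  (Real.exp t • L.rot (4 * t / ‖p.1‖ ^ 2) p.2 p.1, Real.exp (2 * t) • p.2)

/-- The generator `R` of the flow `TwoStepAlgebra.flow`. -/
noncomputable def flowField (p : V × Z) : V × Z :=
  (p.1 + (4 / ‖p.1‖ ^ 2) • L.J p.2 p.1, (2 : ℝ) • p.2)

variable {L}

theorem IsHType.norm_rot (hL : L.IsHType) (s : ℝ) (z : Z) (v : V) : ‖L.rot s z v‖ = ‖v‖ := by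
  rw [← sq_eq_sq₀ (by positivity) (by positivity), rot, norm_add_sq_real, inner_smul_left,
    inner_smul_right, real_inner_comm, L.inner_J_self, norm_smul, norm_smul, hL.norm_J]
  rcases eq_or_ne z 0 with rfl | hz
  · simp
  · have hz' : ‖z‖ ≠ 0 := norm_ne_zero_iff.2 hz
    simp only [mul_zero, add_zero, mul_pow, Real.norm_eq_abs, sq_abs, div_pow]
    field_simp
    linear_combination ‖v‖ ^ 2 * Real.cos_sq_add_sin_sq (s * ‖z‖)

theorem IsHType.hasDerivAt_rot (hL : L.IsHType) (z : Z) (v : V) (s : ℝ) :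
    HasDerivAt (fun s => L.rot s z v) (L.J z (L.rot s z v)) s := by
  have h : HasDerivAt (fun s : ℝ => s * ‖z‖) ‖z‖ s := hasDerivAt_mul_const ‖z‖
  have h1 := (h.cos.smul_const v).add ((h.sin.div_const ‖z‖).smul_const (L.J z v))
  refine h1.congr_deriv ?_
  simp only [rot, map_add, map_smul, hL.J_J]
  rcases eq_or_ne z 0 with rfl | hz
  · simp
  · have hz' : ‖z‖ ≠ 0 := norm_ne_zero_iff.2 hz
    rw [smul_neg, smul_smul, add_comm, ← sub_eq_add_neg, mul_div_assoc, div_self hz', mul_one,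
      neg_mul, neg_smul, ← sub_eq_add_neg]
    congr 2
    field_simp

/-- `TwoStepAlgebra.rot` as a linear isometry. -/
noncomputable def IsHType.rotEquiv (hL : L.IsHType) (s : ℝ) (z : Z) : V ≃ₗᵢ[ℝ] V :=
  LinearIsometry.toLinearIsometryEquiv
    { toFun := L.rot s z
      map_add' := fun u v => by simp only [rot, map_add, smul_add]; abel
      map_smul' := fun c v => by
        simp only [rot, map_smul, smul_add, RingHom.id_apply, smul_comm c]
      norm_map' := hL.norm_rot s z } rfl

theorem IsHType.rotEquiv_apply (hL : L.IsHType) (s : ℝ) (z : Z) (v : V) :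
    hL.rotEquiv s z v = L.rot s z v := rfl

theorem IsHType.norm_flow_fst (hL : L.IsHType) (t : ℝ) (p : V × Z) :
    ‖(L.flow t p).1‖ = Real.exp t * ‖p.1‖ := by
  simp [flow, norm_smul, hL.norm_rot]

theorem norm_flow_snd (t : ℝ) (p : V × Z) : ‖(L.flow t p).2‖ = Real.exp t ^ 2 * ‖p.2‖ := by
  simp [flow, norm_smul, ← Real.exp_nat_mul]

theorem IsHType.hasDerivAt_flow (hL : L.IsHType) {p : V × Z} (hp : p.1 ≠ 0) (t : ℝ) :
    HasDerivAt (fun t => L.flow t p) (L.flowField (L.flow t p)) t := by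
  have hv : ‖p.1‖ ≠ 0 := norm_ne_zero_iff.2 hp
  have h1 : HasDerivAt (fun t : ℝ => 4 * t / ‖p.1‖ ^ 2) (4 / ‖p.1‖ ^ 2) t := by
    simpa using ((hasDerivAt_id t).const_mul (4 : ℝ)).div_const (‖p.1‖ ^ 2)
  have h2 := (hL.hasDerivAt_rot p.2 p.1 (4 * t / ‖p.1‖ ^ 2)).scomp t h1
  have h3 := (Real.hasDerivAt_exp t).smul h2
  have h4 : HasDerivAt (fun t : ℝ => Real.exp (2 * t)) (Real.exp (2 * t) * 2) t :=
    (hasDerivAt_const_mul (2 : ℝ)).exp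
  refine (h3.prodMk (h4.smul_const p.2)).congr_deriv ?_
  ext
  · simp only [flowField, hL.norm_flow_fst]
    simp only [flow, map_smul, LinearMap.smul_apply, Function.comp_apply]
    rw [add_comm, smul_smul, smul_smul, smul_smul]
    congr 2
    rw [two_mul, Real.exp_add, mul_pow]
    have := (Real.exp_pos t).ne'
    field_simp
  · simp [flowField, flow, smul_smul, mul_comm]

theorem contDiff_flow (p : V × Z) : ContDiff ℝ ∞ fun t => L.flow t p := by
  unfold flow rot
  fun_prop

theorem measurable_rot [MeasurableSpace V] [BorelSpace V] [MeasurableSpace Z] [BorelSpace Z]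
    {X : Type*} [MeasurableSpace X] {s : X → ℝ} {z : X → Z} {v : X → V} (hs : Measurable s)
    (hz : Measurable z) (hv : Measurable v) : Measurable fun x => L.rot (s x) (z x) (v x) := by
  have hc : Continuous fun q : Z × V => L.J q.1 q.2 := L.continuous_J continuous_fst continuous_snd
  have hJ : Measurable fun x => L.J (z x) (v x) := by
    -- unification would otherwise unfold the definition of `J`
    generalize L.J = J at *
    exact hc.measurable.comp (hz.prodMk hv)
  have hn : Measurable fun x => s x * ‖z x‖ := hs.mul hz.norm
  exact (hn.cos.smul hv).add ((hn.sin.div hz.norm).smul hJ)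

theorem measurable_flow [MeasurableSpace V] [BorelSpace V] [MeasurableSpace Z] [BorelSpace Z] :
    Measurable fun q : ℝ × (V × Z) => L.flow q.1 q.2 := by
  have hs : Measurable fun q : ℝ × (V × Z) => 4 * q.1 / ‖q.2.1‖ ^ 2 := by fun_prop
  have hv : Measurable fun q : ℝ × (V × Z) => q.2.1 := by fun_prop
  have hz : Measurable fun q : ℝ × (V × Z) => q.2.2 := by fun_prop
  have he : Measurable fun q : ℝ × (V × Z) => Real.exp (2 * q.1) := by fun_prop
  exact (measurable_fst.exp.smul (measurable_rot hs hz hv)).prodMk (he.smul hz)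

variable [MeasurableSpace V] [BorelSpace V] [MeasurableSpace Z] [BorelSpace Z]

theorem IsHType.measurePreserving_rot (hL : L.IsHType) (t : ℝ) :
    MeasurePreserving (fun p : V × Z => (L.rot (t / ‖p.1‖ ^ 2) p.2 p.1, p.2)) volume volume := by
  have := L.nontrivial_fst
  have hm : Measurable (Function.uncurry fun (z : Z) (v : V) => L.rot (t / ‖v‖ ^ 2) z v) :=
    measurable_rot (s := fun q : Z × V => t / ‖q.2‖ ^ 2) (by fun_prop) measurable_fst measurable_snd
  have h1 : MeasurePreserving (fun q : Z × V => (q.1, L.rot (t / ‖q.2‖ ^ 2) q.1 q.2))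
      (volume.prod volume) (volume.prod volume) := by
    refine MeasurePreserving.skew_product (f := id) (g := fun z v => L.rot (t / ‖v‖ ^ 2) z v)
      (MeasurePreserving.id (volume : Measure Z)) hm (Filter.Eventually.of_forall fun z => ?_)
    have hz : Measurable fun v : V => L.rot (t / ‖v‖ ^ 2) z v :=
      measurable_rot (by fun_prop) measurable_const measurable_id
    have := measurePreserving_radial_isometry (fun r => hL.rotEquiv (t / r ^ 2) z)
      (by simpa only [IsHType.rotEquiv_apply] using hz)
    simp only [IsHType.rotEquiv_apply] at this
    exact this.map_eq
  have h2 := (Measure.measurePreserving_swap (μ := (volume : Measure Z))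
    (ν := (volume : Measure V))).comp (h1.comp (Measure.measurePreserving_swap
      (μ := (volume : Measure V)) (ν := (volume : Measure Z))))
  exact h2

/-- The dilation `(v, z) ↦ (r v, r² z)` scales Lebesgue measure by the power `-(m + 2k)` of `r`. -/
theorem map_dilation {r : ℝ} (hr : 0 < r) :
    Measure.map (Prod.map (r • ·) (r ^ 2 • ·)) (volume : Measure (V × Z))
      = ENNReal.ofReal ((r ^ (Module.finrank ℝ V + 2 * Module.finrank ℝ Z))⁻¹) • volume := by
  rw [Measure.volume_eq_prod, ← Measure.map_prod_map _ _ (by fun_prop) (by fun_prop),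
    Measure.map_addHaar_smul _ hr.ne', Measure.map_addHaar_smul _ (by positivity),
    Measure.prod_smul_left, Measure.prod_smul_right, smul_smul, ← ENNReal.ofReal_mul (by positivity),
    abs_of_pos (by positivity), abs_of_pos (by positivity), ← pow_mul, ← mul_inv, ← pow_add]

/-- The flow multiplies Lebesgue measure by `e^{Qt}`, where `Q = m + 2k`. -/
theorem IsHType.lintegral_flow (hL : L.IsHType) (t : ℝ) (F : V × Z → ℝ≥0∞) (hF : Measurable F) :
    ∫⁻ p, ENNReal.ofReal (Real.exp ((Module.finrank ℝ V + 2 * Module.finrank ℝ Z) * t))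
      * F (L.flow t p) = ∫⁻ p, F p := by
  have h1 : ∀ p, F (L.flow t p) = F (Prod.map (Real.exp t • ·) (Real.exp t ^ 2 • ·)
      (L.rot (4 * t / ‖p.1‖ ^ 2) p.2 p.1, p.2)) := fun p => by
    simp [flow, ← Real.exp_nat_mul]
  have hD : Measurable (Prod.map (Real.exp t • ·) (Real.exp t ^ 2 • ·) : V × Z → V × Z) := by
    fun_prop
  rw [lintegral_const_mul' _ _ ENNReal.ofReal_ne_top]
  simp_rw [h1]
  rw [(hL.measurePreserving_rot (4 * t)).lintegral_comp (f := fun q => F (Prod.map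
    (Real.exp t • ·) (Real.exp t ^ 2 • ·) q)) (hF.comp hD), ← lintegral_map hF hD,
    map_dilation (Real.exp_pos t), lintegral_smul_measure, smul_eq_mul, ← mul_assoc,
    ← ENNReal.ofReal_mul (by positivity), ← Real.exp_nat_mul]
  rw [← Real.exp_neg, ← Real.exp_add]
  simp

end TwoStepAlgebra

/-! ### Haar measure and horizontal gradients in exponential coordinates -/

namespace TwoStepAlgebra

section Haar

variable {V Z : Type*} [NormedAddCommGroup V] [InnerProductSpace ℝ V] [FiniteDimensional ℝ V]
  [NormedAddCommGroup Z] [InnerProductSpace ℝ Z] [FiniteDimensional ℝ Z] (L : TwoStepAlgebra V Z)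

/-- Exponential coordinates as a linear isomorphism `V₁ × V₂ ≃ G`. -/
noncomputable def coord {V Z : Type*} [NormedAddCommGroup V] [InnerProductSpace ℝ V]
    [NormedAddCommGroup Z] [InnerProductSpace ℝ Z] (L : TwoStepAlgebra V Z) :
    (V × Z) ≃L[ℝ] L.Grp :=
  ContinuousLinearEquiv.refl ℝ (V × Z)

theorem coord_apply {V Z : Type*} [NormedAddCommGroup V] [InnerProductSpace ℝ V]
    [NormedAddCommGroup Z] [InnerProductSpace ℝ Z] (L : TwoStepAlgebra V Z) (p : V × Z) :
    L.coord p = L.exp p.1 p.2 := rfl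

theorem continuous_vCoord {V Z : Type*} [NormedAddCommGroup V] [InnerProductSpace ℝ V]
    [NormedAddCommGroup Z] [InnerProductSpace ℝ Z] (L : TwoStepAlgebra V Z) :
    Continuous L.vCoord := continuous_fst.comp L.coord.symm.continuous

theorem continuous_zCoord {V Z : Type*} [NormedAddCommGroup V] [InnerProductSpace ℝ V]
    [NormedAddCommGroup Z] [InnerProductSpace ℝ Z] (L : TwoStepAlgebra V Z) :
    Continuous L.zCoord := continuous_snd.comp L.coord.symm.continuous

instance : FiniteDimensional ℝ L.Grp := L.coord.toLinearEquiv.finiteDimensional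

instance : IsTopologicalGroup L.Grp where
  continuous_mul := by
    refine L.coord.continuous.comp (f := fun x : L.Grp × L.Grp =>
      (L.vCoord x.1 + L.vCoord x.2, L.zCoord x.1 + L.zCoord x.2 +
        (1 / 2 : ℝ) • L.bracket (L.vCoord x.1) (L.vCoord x.2))) ?_
    have h1 := L.continuous_vCoord.comp (continuous_fst (X := L.Grp) (Y := L.Grp))
    have h2 := L.continuous_vCoord.comp (continuous_snd (X := L.Grp) (Y := L.Grp))
    have h3 := L.continuous_zCoord.comp (continuous_fst (X := L.Grp) (Y := L.Grp))
    have h4 := L.continuous_zCoord.comp (continuous_snd (X := L.Grp) (Y := L.Grp))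
    exact (h1.add h2).prodMk ((h3.add h4).add ((L.continuous_bracket h1 h2).const_smul _))
  continuous_inv := by
    refine L.coord.continuous.comp (f := fun x : L.Grp => (-L.vCoord x, -L.zCoord x)) ?_
    exact L.continuous_vCoord.neg.prodMk L.continuous_zCoord.neg

variable [MeasurableSpace V] [BorelSpace V] [MeasurableSpace Z] [BorelSpace Z]

/-- In exponential coordinates, left translations are shears composed with translations, so they
preserve Lebesgue measure. -/
theorem measurePreserving_mul_left (x : L.Grp) :
    MeasurePreserving (fun p : V × Z => (L.vCoord x + p.1, L.zCoord x + p.2 +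
      (1 / 2 : ℝ) • L.bracket (L.vCoord x) p.1)) volume volume := by
  have hm : Measurable (Function.uncurry fun (v : V) (z : Z) => L.zCoord x + z +
      (1 / 2 : ℝ) • L.bracket (L.vCoord x) v) := by
    have h := L.continuous_bracket (continuous_const (y := L.vCoord x))
      (continuous_fst (X := V) (Y := Z))
    exact ((continuous_const.add continuous_snd).add (h.const_smul _)).measurable
  refine MeasurePreserving.skew_product (f := fun v => L.vCoord x + v)
    (g := fun v z => L.zCoord x + z + (1 / 2 : ℝ) • L.bracket (L.vCoord x) v)
    (measurePreserving_add_left volume _) hm (Filter.Eventually.of_forall fun v => ?_)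
  have h := measurePreserving_add_left (volume : Measure Z)
    (L.zCoord x + (1 / 2 : ℝ) • L.bracket (L.vCoord x) v)
  refine Eq.trans ?_ h.map_eq
  congr 1
  ext z
  abel

/-- Every Haar measure is a multiple of Lebesgue measure in exponential coordinates. -/
theorem exists_lintegral_haar_eq (μ : Measure L.Grp) [μ.IsHaarMeasure] :
    ∃ c : ℝ≥0∞, c ≠ 0 ∧ c ≠ ⊤ ∧ ∀ F : L.Grp → ℝ≥0∞,
      ∫⁻ x, F x ∂μ = c * ∫⁻ p : V × Z, F (L.exp p.1 p.2) := by
  have : SecondCountableTopology L.Grp := inferInstance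
  have : LocallyCompactSpace L.Grp := inferInstance
  let e : (V × Z) ≃ᵐ L.Grp := L.coord.toHomeomorph.toMeasurableEquiv
  let ν : Measure L.Grp := (volume : Measure (V × Z)).map e
  have hνe : ∀ F : L.Grp → ℝ≥0∞, ∫⁻ x, F x ∂ν = ∫⁻ p : V × Z, F (L.exp p.1 p.2) :=
    fun F => lintegral_map_equiv F e
  have hinv : ν.IsMulLeftInvariant := by
    refine ⟨fun x => ?_⟩
    rw [Measure.map_map (measurable_const_mul x) e.measurable]
    have := (L.measurePreserving_mul_left x).map_eq
    change Measure.map ((x * ·) ∘ e) volume = Measure.map e volume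
    conv_rhs => rw [← this]
    rw [Measure.map_map e.measurable (L.measurePreserving_mul_left x).measurable]
    rfl
  have hfin : IsFiniteMeasureOnCompacts ν := by
    refine ⟨fun s hs => ?_⟩
    rw [e.map_apply]
    exact (L.coord.toHomeomorph.isCompact_preimage.2 hs).measure_lt_top
  have h := Measure.isMulLeftInvariant_eq_smul ν μ
  set c := Measure.haarScalarFactor ν μ
  have hc : c ≠ 0 := by
    intro hc
    rw [hc, zero_smul] at h
    have := hνe 1
    simp only [h, Pi.one_apply, lintegral_one] at this
    exact (isOpen_univ.measure_pos volume Set.univ_nonempty).ne this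
  refine ⟨(c : ℝ≥0∞)⁻¹, by simp, by simpa using hc, fun F => ?_⟩
  rw [← hνe, h, lintegral_smul_measure, ENNReal.smul_def, smul_eq_mul, ← mul_assoc,
    ENNReal.inv_mul_cancel (by simpa using hc) (by simp), one_mul]

end Haar

section Calculus

variable {V Z : Type*} [NormedAddCommGroup V] [InnerProductSpace ℝ V]
  [NormedAddCommGroup Z] [InnerProductSpace ℝ Z] (L : TwoStepAlgebra V Z)

theorem mul_exp_smul (x : L.Grp) (u : V) (t : ℝ) :
    x * L.exp (t • u) 0 = x + t • L.exp u ((1 / 2 : ℝ) • L.bracket (L.vCoord x) u) := by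
  refine Prod.ext rfl ?_
  change L.zCoord x + 0 + (1 / 2 : ℝ) • L.bracket (L.vCoord x) (t • u) =
    L.zCoord x + t • (1 / 2 : ℝ) • L.bracket (L.vCoord x) u
  rw [map_smul, add_zero, smul_comm]

theorem leftInvDeriv_eq_fderiv {f : L.Grp → ℝ} {x : L.Grp} (hf : DifferentiableAt ℝ f x) (u : V) :
    L.leftInvDeriv u f x
      = fderiv ℝ f x (L.exp u ((1 / 2 : ℝ) • L.bracket (L.vCoord x) u)) := by
  simp only [leftInvDeriv, mul_exp_smul]
  exact HasDerivAt.deriv (hf.hasFDerivAt.hasLineDerivAt _)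

/-- If the horizontal derivatives are the pairings with a vector `g ∈ V₁`, then the horizontal
gradient has length `‖g‖`. -/
theorem norm_hGrad_eq {m : ℕ} (b : OrthonormalBasis (Fin m) ℝ V) {f : L.Grp → ℝ} {x : L.Grp}
    {g : V} (hg : ∀ u, L.leftInvDeriv u f x = inner ℝ g u) : ‖L.hGrad b f x‖ = ‖g‖ := by
  rw [← b.repr.norm_map g]
  congr 1
  ext i
  simp [hGrad, hg, b.repr_apply_apply, real_inner_comm]

theorem abs_leftInvDeriv_le [FiniteDimensional ℝ V] {m : ℕ} (b : OrthonormalBasis (Fin m) ℝ V)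
    {f : L.Grp → ℝ} {x : L.Grp} (hf : DifferentiableAt ℝ f x) (u : V) :
    |L.leftInvDeriv u f x| ≤ ‖L.hGrad b f x‖ * ‖u‖ := by
  let ℓ : V →ₗ[ℝ] ℝ := (fderiv ℝ f x).toLinearMap ∘ₗ L.coord.toLinearMap ∘ₗ
    (LinearMap.id.prod ((1 / 2 : ℝ) • L.bracket (L.vCoord x)))
  let g : V := (InnerProductSpace.toDual ℝ V).symm (LinearMap.toContinuousLinearMap ℓ)
  have hg : ∀ u, L.leftInvDeriv u f x = inner ℝ g u := fun u => by
    rw [L.leftInvDeriv_eq_fderiv hf, InnerProductSpace.toDual_symm_apply]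
    rfl
  rw [L.norm_hGrad_eq b hg, hg]
  exact abs_real_inner_le_norm g u

theorem K_nonneg (x : L.Grp) : 0 ≤ L.K x := by unfold K; positivity

theorem K_pow_four (x : L.Grp) : L.K x ^ 4 = ‖L.vCoord x‖ ^ 4 + 16 * ‖L.zCoord x‖ ^ 2 := by
  rw [K, ← Real.rpow_natCast, ← Real.rpow_mul (by positivity)]
  norm_num

theorem quartic_pos {x : L.Grp} (hx : x ≠ 1) :
    0 < ‖L.vCoord x‖ ^ 4 + 16 * ‖L.zCoord x‖ ^ 2 := by
  by_contra h
  have h1 : 0 ≤ ‖L.vCoord x‖ ^ 4 := by positivity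
  have h2 : 0 ≤ ‖L.zCoord x‖ ^ 2 := by positivity
  have h3 : ‖L.vCoord x‖ ^ 4 = 0 := by linarith
  have h4 : ‖L.zCoord x‖ ^ 2 = 0 := by linarith
  exact hx (Grp.ext L (by simpa using h3) (by simpa using h4))

theorem K_pos {x : L.Grp} (hx : x ≠ 1) : 0 < L.K x := Real.rpow_pos_of_pos (L.quartic_pos hx) _

theorem K_one : L.K 1 = 0 := by simp [K]

theorem continuous_K : Continuous L.K := by
  have h1 := L.continuous_vCoord
  have h2 := L.continuous_zCoord
  unfold K
  exact (by fun_prop : Continuous fun x => ‖L.vCoord x‖ ^ 4 + 16 * ‖L.zCoord x‖ ^ 2).rpow_const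
    fun _ => Or.inr (by norm_num)

theorem contDiff_quartic :
    ContDiff ℝ ∞ fun x : L.Grp => ‖L.vCoord x‖ ^ 4 + 16 * ‖L.zCoord x‖ ^ 2 := by
  have h1 : ContDiff ℝ ∞ L.vCoord := contDiff_fst.comp L.coord.symm.contDiff
  have h2 : ContDiff ℝ ∞ L.zCoord := contDiff_snd.comp L.coord.symm.contDiff
  have h3 : (fun x : L.Grp => ‖L.vCoord x‖ ^ 4 + 16 * ‖L.zCoord x‖ ^ 2)
      = fun x => (‖L.vCoord x‖ ^ 2) ^ 2 + 16 * ‖L.zCoord x‖ ^ 2 := by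
    ext x; ring
  rw [h3]
  exact ((h1.norm_sq ℝ).pow 2).add (contDiff_const.mul (h2.norm_sq ℝ))

theorem contDiffAt_K {x : L.Grp} (hx : x ≠ 1) : ContDiffAt ℝ ∞ L.K x :=
  L.contDiff_quartic.contDiffAt.rpow_const_of_ne (L.quartic_pos hx).ne'

variable [FiniteDimensional ℝ V] [FiniteDimensional ℝ Z]

/-- The horizontal vector `‖v‖² v + 4 J_z v`, which is `K³ ∇_G K`. -/
noncomputable def gaugeGrad (p : V × Z) : V := ‖p.1‖ ^ 2 • p.1 + (4 : ℝ) • L.J p.2 p.1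

variable {L}

theorem IsHType.norm_gaugeGrad (hL : L.IsHType) (v : V) (z : Z) :
    ‖L.gaugeGrad (v, z)‖ = ‖v‖ * L.K (L.exp v z) ^ 2 := by
  have hK := L.K_pow_four (L.exp v z)
  rw [← sq_eq_sq₀ (by positivity) (by positivity), gaugeGrad, norm_add_sq_real, inner_smul_left,
    inner_smul_right, real_inner_comm, L.inner_J_self, norm_smul, norm_smul, hL.norm_J]
  simp only [vCoord_exp, zCoord_exp] at hK
  simp only [norm_pow, norm_norm, Real.norm_ofNat]
  linear_combination -‖v‖ ^ 2 * hK

/-- Derivative of the gauge `K` along a left-invariant horizontal field. -/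
theorem hasDerivAt_K {x : L.Grp} (hx : x ≠ 1) (u : V) :
    HasDerivAt (fun t : ℝ => L.K (x * L.exp (t • u) 0))
      (inner ℝ ((L.K x ^ 3)⁻¹ • L.gaugeGrad (L.vCoord x, L.zCoord x)) u) 0 := by
  have hN := L.quartic_pos hx
  have h1 : HasDerivAt (fun t : ℝ => L.vCoord x + t • u) u 0 := by
    simpa using ((hasDerivAt_id (0 : ℝ)).smul_const u).const_add (L.vCoord x)
  have h2 : HasDerivAt (fun t : ℝ => L.zCoord x + t • (1 / 2 : ℝ) • L.bracket (L.vCoord x) u)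
      ((1 / 2 : ℝ) • L.bracket (L.vCoord x) u) 0 := by
    simpa using ((hasDerivAt_id (0 : ℝ)).smul_const
      ((1 / 2 : ℝ) • L.bracket (L.vCoord x) u)).const_add (L.zCoord x)
  have h3 : HasDerivAt (fun t : ℝ => (‖L.vCoord x + t • u‖ ^ 2) ^ 2 +
      16 * ‖L.zCoord x + t • (1 / 2 : ℝ) • L.bracket (L.vCoord x) u‖ ^ 2) _ 0 :=
    (h1.norm_sq.pow 2).add (h2.norm_sq.const_mul 16)
  have h4 : (fun t : ℝ => L.K (x * L.exp (t • u) 0)) = fun t => ((‖L.vCoord x + t • u‖ ^ 2) ^ 2 +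
      16 * ‖L.zCoord x + t • (1 / 2 : ℝ) • L.bracket (L.vCoord x) u‖ ^ 2) ^ (1 / 4 : ℝ) := by
    ext t
    simp only [K, ← pow_mul, vCoord_mul, zCoord_mul, vCoord_exp, zCoord_exp, add_zero, map_smul,
      smul_comm t]
  rw [h4]
  refine (h3.rpow_const (p := 1 / 4) (Or.inl (by
    simp only [zero_smul, add_zero, ← pow_mul]
    exact hN.ne'))).congr_deriv ?_
  have h5 : (‖L.vCoord x‖ ^ 4 + 16 * ‖L.zCoord x‖ ^ 2) ^ ((1 / 4 : ℝ) - 1) = (L.K x ^ 3)⁻¹ := by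
    rw [K, ← Real.rpow_mul_natCast hN.le, ← Real.rpow_neg hN.le]
    norm_num
  simp only [zero_smul, add_zero, ← pow_mul]
  norm_num only at h5 ⊢
  rw [h5, inner_smul_left, gaugeGrad, inner_add_left, inner_smul_left, inner_smul_left, L.inner_J,
    inner_smul_right]
  simp
  ring

theorem leftInvDeriv_comp_K {φ : L.Grp → ℝ} {f : ℝ → ℝ} {f' : ℝ} {x : L.Grp} (hx : x ≠ 1)
    (hφ : φ =ᶠ[nhds x] fun y => f (L.K y)) (hf : HasDerivAt f f' (L.K x)) (u : V) :
    L.leftInvDeriv u φ x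
      = inner ℝ (f' • (L.K x ^ 3)⁻¹ • L.gaugeGrad (L.vCoord x, L.zCoord x)) u := by
  have hK := hasDerivAt_K hx u
  have h0 : x * L.exp ((0 : ℝ) • u) 0 = x := by
    rw [zero_smul]; exact mul_one x
  have hf' : HasDerivAt f f' (L.K (x * L.exp ((0 : ℝ) • u) 0)) := by rwa [h0]
  have h1 := hf'.comp (0 : ℝ) hK
  have hc : Filter.Tendsto (fun t : ℝ => x * L.exp (t • u) 0) (nhds 0) (nhds x) := by
    have : Continuous fun t : ℝ => x * L.exp (t • u) 0 := by
      simp only [mul_exp_smul]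
      fun_prop
    simpa only [h0] using this.tendsto 0
  rw [inner_smul_left]
  exact (h1.congr_of_eventuallyEq (hc.eventually hφ)).deriv

theorem IsHType.norm_hGrad_comp_K (hL : L.IsHType) {m : ℕ} (b : OrthonormalBasis (Fin m) ℝ V)
    {φ : L.Grp → ℝ} {f : ℝ → ℝ} {f' : ℝ} {x : L.Grp} (hx : x ≠ 1)
    (hφ : φ =ᶠ[nhds x] fun y => f (L.K y)) (hf : HasDerivAt f f' (L.K x)) :
    ‖L.hGrad b φ x‖ = |f'| * (‖L.vCoord x‖ / L.K x) := by
  rw [L.norm_hGrad_eq b (leftInvDeriv_comp_K hx hφ hf), norm_smul, norm_smul, hL.norm_gaugeGrad,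
    Real.norm_eq_abs, norm_inv, norm_pow, Real.norm_of_nonneg (L.K_nonneg x)]
  have hK := (L.K_pos hx).ne'
  change |f'| * ((L.K x ^ 3)⁻¹ * (‖L.vCoord x‖ * L.K x ^ 2)) = _
  field_simp

theorem IsHType.norm_hGrad_K (hL : L.IsHType) {m : ℕ} (b : OrthonormalBasis (Fin m) ℝ V)
    {x : L.Grp} (hx : x ≠ 1) : ‖L.hGrad b L.K x‖ = ‖L.vCoord x‖ / L.K x := by
  simpa using hL.norm_hGrad_comp_K b hx (f := id) (Filter.EventuallyEq.refl _ _) (hasDerivAt_id _)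

/-- The derivative along the radial field `R` is controlled by the horizontal gradient, because
`‖v‖² R` is the left-invariant horizontal direction `‖v‖² v + 4 J_z v` at `(v, z)`. -/
theorem IsHType.norm_mul_abs_fderiv_flowField_le (hL : L.IsHType) {m : ℕ}
    (b : OrthonormalBasis (Fin m) ℝ V) {φ : L.Grp → ℝ} {p : V × Z}
    (hφ : DifferentiableAt ℝ φ (L.exp p.1 p.2)) (hp : p.1 ≠ 0) :
    ‖p.1‖ * |fderiv ℝ φ (L.exp p.1 p.2) (L.coord (L.flowField p))|
      ≤ L.K (L.exp p.1 p.2) ^ 2 * ‖L.hGrad b φ (L.exp p.1 p.2)‖ := by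
  have hv : 0 < ‖p.1‖ := norm_pos_iff.2 hp
  have h := L.abs_leftInvDeriv_le b hφ (L.gaugeGrad p)
  have he : L.exp (L.gaugeGrad p) ((1 / 2 : ℝ) • L.bracket (L.vCoord (L.exp p.1 p.2))
      (L.gaugeGrad p)) = ‖p.1‖ ^ 2 • L.coord (L.flowField p) := by
    change _ = L.exp (‖p.1‖ ^ 2 • (L.flowField p).1) (‖p.1‖ ^ 2 • (L.flowField p).2)
    congr 1
    · simp only [gaugeGrad, flowField, smul_add, smul_smul]
      congr 2
      field_simp
    · simp only [gaugeGrad, flowField, vCoord_exp, map_add, map_smul, L.bracket_self,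
        hL.bracket_J, smul_zero, zero_add, smul_smul]
      congr 1
      ring
  rw [L.leftInvDeriv_eq_fderiv hφ, he, map_smul, smul_eq_mul, abs_mul, abs_of_nonneg (sq_nonneg _),
    show p = (p.1, p.2) from rfl, hL.norm_gaugeGrad] at h
  refine le_of_mul_le_mul_left ?_ hv
  linarith

theorem IsHType.K_flow (hL : L.IsHType) (t : ℝ) (p : V × Z) :
    L.K (L.coord (L.flow t p)) = Real.exp t * L.K (L.coord p) := by
  rw [← pow_left_inj₀ (L.K_nonneg _) (mul_nonneg (Real.exp_pos t).le (L.K_nonneg _))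
    (n := 4) (by norm_num), mul_pow, K_pow_four, K_pow_four]
  change ‖(L.flow t p).1‖ ^ 4 + 16 * ‖(L.flow t p).2‖ ^ 2 = _
  rw [hL.norm_flow_fst, norm_flow_snd]
  change _ = _ * (‖p.1‖ ^ 4 + 16 * ‖p.2‖ ^ 2)
  ring

end Calculus

end TwoStepAlgebra

/-! ### Hardy's inequality on the line and disintegration along orbits -/

theorem HasCompactSupport.fun_sq {f : ℝ → ℝ} (hf : HasCompactSupport f) :
    HasCompactSupport fun t => f t ^ 2 := by
  simp_rw [sq]
  exact hf.mul_left

/-- The one-dimensional Hardy identity with exponential weight. It follows by expanding the square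
in `e^{at/2} f' = g' - (a/2) g` with `g = e^{at/2} f`, since `∫ g g' = 0`. -/
theorem integral_exp_mul_deriv_sq {f : ℝ → ℝ} (hf : ContDiff ℝ 1 f) (hc : HasCompactSupport f)
    (a : ℝ) :
    ∫ t, Real.exp (a * t) * deriv f t ^ 2
      = (∫ t, deriv (fun s => Real.exp (a / 2 * s) * f s) t ^ 2)
        + (a / 2) ^ 2 * ∫ t, Real.exp (a * t) * f t ^ 2 := by
  obtain ⟨g, hg⟩ : ∃ g : ℝ → ℝ, g = fun s => Real.exp (a / 2 * s) * f s := ⟨_, rfl⟩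
  rw [← hg]
  have hgC : ContDiff ℝ 1 g := by rw [hg]; fun_prop
  have hgc : HasCompactSupport g := by rw [hg]; exact hc.mul_left
  have hgd : ∀ t, HasDerivAt g (deriv g t) t := fun t =>
    (hgC.differentiable (by norm_num) t).hasDerivAt
  have hgcont : Continuous (deriv g) := hgC.continuous_deriv (by norm_num)
  have hgd' : ∀ t, deriv g t = a / 2 * g t + Real.exp (a / 2 * t) * deriv f t := fun t => by
    have h1 : HasDerivAt (fun s : ℝ => Real.exp (a / 2 * s)) (Real.exp (a / 2 * t) * (a / 2)) t :=
      (hasDerivAt_const_mul (a / 2)).exp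
    have h2 := (hf.differentiable (by norm_num) t).hasDerivAt
    rw [hg, (h1.fun_mul h2).deriv]
    ring
  have hexp : ∀ t, Real.exp (a * t) = Real.exp (a / 2 * t) ^ 2 := fun t => by
    rw [← Real.exp_nat_mul]
    congr 1
    push_cast
    ring
  have i1 : Integrable fun t => deriv g t ^ 2 :=
    Continuous.integrable_of_hasCompactSupport (by fun_prop) hgc.deriv.fun_sq
  have i2 : Integrable fun t => g t ^ 2 :=
    Continuous.integrable_of_hasCompactSupport (by fun_prop) hgc.fun_sq
  have i3 : Integrable fun t => 2 * g t * deriv g t :=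
    ((continuous_const.mul hgC.continuous).mul hgcont).integrable_of_hasCompactSupport
      hgc.deriv.mul_left
  have h0 : ∫ t, 2 * g t * deriv g t = 0 := by
    refine integral_eq_zero_of_hasDerivAt_of_integrable (f := fun t => g t ^ 2) (fun t => ?_) i3 i2
    simpa using (hgd t).fun_pow 2
  have e1 : ∀ t, Real.exp (a * t) * deriv f t ^ 2
      = deriv g t ^ 2 + (a / 2) ^ 2 * g t ^ 2 - a / 2 * (2 * g t * deriv g t) := fun t => by
    rw [hexp, hgd' t]
    ring
  have e2 : ∀ t, Real.exp (a * t) * f t ^ 2 = g t ^ 2 := fun t => by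
    rw [hexp, hg]
    ring
  simp_rw [e1, e2]
  have i4 : Integrable fun t => deriv g t ^ 2 + (a / 2) ^ 2 * g t ^ 2 := i1.add (i2.const_mul _)
  rw [integral_sub i4 (i3.const_mul _), integral_add i1 (i2.const_mul _),
    integral_const_mul, integral_const_mul, h0]
  ring

/-- Sharpness in one dimension: test the inequality on `e^{-at/2} χ(ε t)` with a bump `χ`. -/
theorem exists_integral_exp_mul_deriv_sq_lt (a C : ℝ) (hC : (a / 2) ^ 2 < C) :
    ∃ f : ℝ → ℝ, ContDiff ℝ ∞ f ∧ HasCompactSupport f ∧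
      ∫ t, Real.exp (a * t) * deriv f t ^ 2 < C * ∫ t, Real.exp (a * t) * f t ^ 2 := by
  let χ : ContDiffBump (0 : ℝ) := default
  have hχ : ContDiff ℝ ∞ χ := χ.contDiff
  have hB : 0 < ∫ t, χ t ^ 2 := by
    have hcont : Continuous fun t => χ t ^ 2 := hχ.continuous.pow 2
    refine hcont.integral_pos_of_hasCompactSupport_nonneg_nonzero
      χ.hasCompactSupport.fun_sq
      (fun t => sq_nonneg _) (x := 0) ?_
    have : χ 0 = 1 := χ.one_of_mem_closedBall (Metric.mem_closedBall_self χ.rIn_pos.le)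
    simp [this]
  set B := ∫ t, χ t ^ 2
  set A := ∫ t, deriv χ t ^ 2
  have hA : 0 ≤ A := integral_nonneg fun t => sq_nonneg _
  have hd : 0 < C - (a / 2) ^ 2 := sub_pos.2 hC
  -- `ε` is chosen so that `ε² A < (C - (a/2)²) B`
  set ε := Real.sqrt ((C - (a / 2) ^ 2) * B / (A + 1)) with hε
  have hε0 : 0 < ε := Real.sqrt_pos.2 (by positivity)
  have hε2 : ε ^ 2 * A < (C - (a / 2) ^ 2) * B := by
    rw [hε, Real.sq_sqrt (by positivity), div_mul_eq_mul_div, div_lt_iff₀ (by positivity)]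
    have : 0 < (C - (a / 2) ^ 2) * B := by positivity
    nlinarith
  let g : ℝ → ℝ := fun t => χ (ε * t)
  have hg : ContDiff ℝ ∞ g := hχ.comp (contDiff_const.mul contDiff_id)
  have hgc : HasCompactSupport g :=
    χ.hasCompactSupport.comp_homeomorph (Homeomorph.mulLeft₀ ε hε0.ne')
  let f : ℝ → ℝ := fun t => Real.exp (-(a / 2) * t) * g t
  have hf : ContDiff ℝ ∞ f := by fun_prop
  have hfc : HasCompactSupport f := hgc.mul_left
  refine ⟨f, hf, hfc, ?_⟩
  have hfg : (fun s => Real.exp (a / 2 * s) * f s) = g := by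
    ext s
    simp only [f]
    rw [← mul_assoc, ← Real.exp_add]
    simp
  have hsq : ∀ t, Real.exp (a * t) * f t ^ 2 = χ (ε * t) ^ 2 := fun t => by
    simp only [f, g]
    rw [mul_pow, ← mul_assoc, ← Real.exp_nat_mul, ← Real.exp_add]
    have : a * t + (2 : ℕ) * (-(a / 2) * t) = 0 := by push_cast; ring
    rw [this, Real.exp_zero, one_mul]
  have hgd : ∀ t, deriv g t = ε * deriv χ (ε * t) := fun t => by
    have := deriv_comp_mul_left ε χ t
    simpa using this
  rw [integral_exp_mul_deriv_sq (hf.of_le (by norm_num)) hfc, hfg]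
  simp_rw [hsq, hgd, mul_pow]
  rw [integral_const_mul, Measure.integral_comp_mul_left (fun t => χ t ^ 2),
    Measure.integral_comp_mul_left (fun t => deriv χ t ^ 2), abs_of_pos (by positivity)]
  simp only [smul_eq_mul]
  change ε ^ 2 * (ε⁻¹ * A) + (a / 2) ^ 2 * (ε⁻¹ * B) < C * (ε⁻¹ * B)
  have : ε⁻¹ * (ε ^ 2 * A) < ε⁻¹ * ((C - (a / 2) ^ 2) * B) := by gcongr
  linarith

theorem lintegral_const_mul_exp_mul_sq {f : ℝ → ℝ} (hf : Continuous f) (hc : HasCompactSupport f)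
    (a : ℝ) {w : ℝ} (hw : 0 ≤ w) :
    ∫⁻ t, ENNReal.ofReal (w * (Real.exp (a * t) * f t ^ 2))
      = ENNReal.ofReal (w * ∫ t, Real.exp (a * t) * f t ^ 2) := by
  have hi : Integrable fun t => Real.exp (a * t) * f t ^ 2 := by
    refine Continuous.integrable_of_hasCompactSupport (by fun_prop) ?_
    exact HasCompactSupport.mul_left hc.fun_sq
  rw [← integral_const_mul, ofReal_integral_eq_lintegral_ofReal (hi.const_mul w)]
  exact Filter.Eventually.of_forall fun t => by positivity

/-- The one-dimensional weighted Hardy inequality. -/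
theorem lintegral_exp_mul_sq_le {f : ℝ → ℝ} (hf : ContDiff ℝ 1 f) (hc : HasCompactSupport f)
    (a : ℝ) {w : ℝ} (hw : 0 ≤ w) :
    ENNReal.ofReal ((a / 2) ^ 2) * ∫⁻ t, ENNReal.ofReal (w * (Real.exp (a * t) * f t ^ 2))
      ≤ ∫⁻ t, ENNReal.ofReal (w * (Real.exp (a * t) * deriv f t ^ 2)) := by
  rw [lintegral_const_mul_exp_mul_sq hf.continuous hc a hw,
    lintegral_const_mul_exp_mul_sq (hf.continuous_deriv (by norm_num)) hc.deriv a hw,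
    ← ENNReal.ofReal_mul (sq_nonneg _)]
  refine ENNReal.ofReal_le_ofReal ?_
  rw [integral_exp_mul_deriv_sq hf hc, mul_left_comm]
  refine mul_le_mul_of_nonneg_left ?_ hw
  exact le_add_of_nonneg_left (integral_nonneg fun t => sq_nonneg _)

namespace TwoStepAlgebra

section

variable {V Z : Type*} [NormedAddCommGroup V] [InnerProductSpace ℝ V]
  [NormedAddCommGroup Z] [InnerProductSpace ℝ Z] {L : TwoStepAlgebra V Z}

theorem ne_one_of_fst_ne_zero {p : V × Z} (hp : p.1 ≠ 0) : L.coord p ≠ 1 := fun h =>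
  hp (congrArg L.vCoord h)

/-- The weight `K^{α-2} |∇_G K|^{γ+2}` in exponential coordinates. -/
noncomputable def weight (L : TwoStepAlgebra V Z) (α γ : ℝ) (p : V × Z) : ℝ :=
  L.K (L.coord p) ^ (α - 2) * (‖p.1‖ / L.K (L.coord p)) ^ (γ + 2)

theorem weight_nonneg (α γ : ℝ) (p : V × Z) : 0 ≤ L.weight α γ p := by
  have := L.K_nonneg (L.coord p)
  unfold weight
  positivity

variable [FiniteDimensional ℝ V] [FiniteDimensional ℝ Z]

theorem IsHType.weight_flow (hL : L.IsHType) (α γ t : ℝ) (p : V × Z) :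
    L.weight α γ (L.flow t p) = Real.exp ((α - 2) * t) * L.weight α γ p := by
  have ht := Real.exp_pos t
  unfold weight
  rw [hL.K_flow, hL.norm_flow_fst, mul_div_mul_left _ _ ht.ne', Real.mul_rpow ht.le (L.K_nonneg _),
    ← Real.exp_mul, mul_comm t, mul_assoc]

theorem IsHType.exp_mul_weight_flow (hL : L.IsHType) {a α γ Q : ℝ} (ha : a = Q + α - 2) (t y : ℝ)
    (p : V × Z) :
    ENNReal.ofReal (Real.exp (Q * t)) * ENNReal.ofReal (L.weight α γ (L.flow t p) * y)
      = ENNReal.ofReal (L.weight α γ p * (Real.exp (a * t) * y)) := by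
  rw [← ENNReal.ofReal_mul (Real.exp_pos _).le, hL.weight_flow]
  congr 1
  have : Real.exp (a * t) = Real.exp (Q * t) * Real.exp ((α - 2) * t) := by
    rw [← Real.exp_add, ha]
    congr 1
    ring
  rw [this]
  ring

end

variable {V Z : Type*} [NormedAddCommGroup V] [InnerProductSpace ℝ V] [FiniteDimensional ℝ V]
  [NormedAddCommGroup Z] [InnerProductSpace ℝ Z] [FiniteDimensional ℝ Z] {L : TwoStepAlgebra V Z}
  [MeasurableSpace V] [BorelSpace V] [MeasurableSpace Z] [BorelSpace Z]

/-- The indicator function of the fundamental domain `[1, e)` of multiplication by `e` on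
`(0, ∞)`. -/
noncomputable def shell (r : ℝ) : ℝ≥0∞ := Set.indicator (Set.Ico 1 (Real.exp 1)) 1 r

theorem measurable_shell : Measurable shell := measurable_one.indicator measurableSet_Ico

theorem lintegral_shell {r : ℝ} (hr : 0 < r) : ∫⁻ t, shell (Real.exp (-t) * r) = 1 := by
  have h : ∀ t, shell (Real.exp (-t) * r) =
      Set.indicator (Set.Ioc (Real.log r - 1) (Real.log r)) 1 t := fun t => by
    unfold shell
    rw [Set.indicator_apply, Set.indicator_apply]
    refine if_congr ?_ rfl rfl
    conv_lhs => rw [← Real.exp_log hr, ← Real.exp_add]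
    rw [Set.mem_Ico, Set.mem_Ioc, Real.exp_lt_exp, Real.one_le_exp_iff]
    constructor <;> rintro ⟨h1, h2⟩ <;> constructor <;> linarith
  simp_rw [h]
  rw [lintegral_indicator_one measurableSet_Ioc, Real.volume_Ioc]
  simp

theorem ae_fst_ne_zero (L : TwoStepAlgebra V Z) : ∀ᵐ p : V × Z, p.1 ≠ 0 := by
  have := L.nontrivial_fst
  have h : ∀ᵐ v : V, v ≠ 0 := by
    rw [ae_iff]
    simp
  exact Measure.quasiMeasurePreserving_fst.ae h

/-- Disintegration of Lebesgue measure along the orbits of the flow, which meet the shell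
`1 ≤ K < e` in a time interval of length one. -/
theorem IsHType.lintegral_eq_lintegral_orbits (hL : L.IsHType) {F : V × Z → ℝ≥0∞}
    (hF : Measurable F) :
    ∫⁻ p, F p = ∫⁻ p, shell (L.K (L.coord p)) *
      ∫⁻ t, ENNReal.ofReal (Real.exp ((Module.finrank ℝ V + 2 * Module.finrank ℝ Z) * t))
        * F (L.flow t p) := by
  have hK : Measurable fun p : V × Z => L.K (L.coord p) :=
    (L.continuous_K.comp L.coord.continuous).measurable
  have hs := measurable_shell
  have hfl := measurable_flow (L := L)
  have h1 : ∫⁻ p, F p = ∫⁻ p, ∫⁻ t, F p * shell (Real.exp (-t) * L.K (L.coord p)) := by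
    refine lintegral_congr_ae ?_
    filter_upwards [L.ae_fst_ne_zero] with p hp
    rw [lintegral_const_mul _ (by fun_prop), lintegral_shell (L.K_pos (ne_one_of_fst_ne_zero hp)),
      mul_one]
  have h2 : ∀ t, ∫⁻ p, F p * shell (Real.exp (-t) * L.K (L.coord p)) = ∫⁻ p,
      ENNReal.ofReal (Real.exp ((Module.finrank ℝ V + 2 * Module.finrank ℝ Z) * t))
        * (F (L.flow t p) * shell (L.K (L.coord p))) := fun t => by
    rw [← hL.lintegral_flow t _ (by fun_prop)]
    refine lintegral_congr fun p => ?_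
    rw [hL.K_flow, ← mul_assoc (Real.exp (-t)), ← Real.exp_add, neg_add_cancel, Real.exp_zero,
      one_mul]
  rw [h1, lintegral_lintegral_swap (by
    refine Measurable.aemeasurable ?_
    exact (hF.comp measurable_fst).mul (hs.comp (measurable_snd.neg.exp.mul
      (hK.comp measurable_fst))))]
  simp_rw [h2]
  have hm : Measurable fun q : ℝ × (V × Z) =>
      ENNReal.ofReal (Real.exp ((Module.finrank ℝ V + 2 * Module.finrank ℝ Z) * q.1))
        * F (L.flow q.1 q.2) := by
    have := hF.comp hfl
    exact (by fun_prop : Measurable fun q : ℝ × (V × Z) =>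
      ENNReal.ofReal (Real.exp ((Module.finrank ℝ V + 2 * Module.finrank ℝ Z) * q.1))).mul this
  rw [lintegral_lintegral_swap (by
    refine Measurable.aemeasurable ?_
    simp_rw [← mul_assoc]
    exact hm.mul (hs.comp (hK.comp measurable_snd)))]
  refine lintegral_congr fun p => ?_
  have hmp : Measurable fun t : ℝ =>
      ENNReal.ofReal (Real.exp ((Module.finrank ℝ V + 2 * Module.finrank ℝ Z) * t))
        * F (L.flow t p) := hm.comp measurable_prodMk_right
  rw [← lintegral_const_mul _ hmp]
  refine lintegral_congr fun t => ?_
  ring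

theorem measurable_weight {V Z : Type*} [NormedAddCommGroup V] [InnerProductSpace ℝ V]
    [NormedAddCommGroup Z] [InnerProductSpace ℝ Z] [FiniteDimensional ℝ Z] {L : TwoStepAlgebra V Z}
    [MeasurableSpace V] [BorelSpace V] [MeasurableSpace Z] [BorelSpace Z]
    (α γ : ℝ) : Measurable (L.weight α γ) := by
  have hK : Measurable fun p : V × Z => L.K (L.coord p) :=
    (L.continuous_K.comp L.coord.continuous).measurable
  unfold weight
  fun_prop

end TwoStepAlgebra

/-! ### The Hardy inequality on the group -/

namespace TwoStepAlgebra

section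

variable {V Z : Type*} [NormedAddCommGroup V] [InnerProductSpace ℝ V]
  [NormedAddCommGroup Z] [InnerProductSpace ℝ Z] {L : TwoStepAlgebra V Z}

theorem norm_fst_le_K (p : V × Z) : ‖p.1‖ ≤ L.K (L.coord p) := by
  have h := L.K_pow_four (L.coord p)
  change _ = ‖p.1‖ ^ 4 + 16 * ‖p.2‖ ^ 2 at h
  refine le_of_pow_le_pow_left₀ (n := 4) (by norm_num) (L.K_nonneg _) ?_
  nlinarith [sq_nonneg ‖p.2‖]

theorem norm_snd_le_K_sq (p : V × Z) : ‖p.2‖ ≤ L.K (L.coord p) ^ 2 := by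
  have h := L.K_pow_four (L.coord p)
  change _ = ‖p.1‖ ^ 4 + 16 * ‖p.2‖ ^ 2 at h
  refine le_of_pow_le_pow_left₀ (n := 2) (by norm_num) (sq_nonneg _) ?_
  have : 0 ≤ ‖p.1‖ ^ 4 := by positivity
  nlinarith [sq_nonneg ‖p.2‖]

theorem weight_eq (α γ : ℝ) {p : V × Z} (hp : p.1 ≠ 0) :
    L.weight α γ p = L.K (L.coord p) ^ α * (‖p.1‖ / L.K (L.coord p)) ^ γ
      * (‖p.1‖ / L.K (L.coord p) ^ 2) ^ 2 := by
  have hK := L.K_pos (ne_one_of_fst_ne_zero (L := L) hp)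
  have hv : 0 < ‖p.1‖ := norm_pos_iff.2 hp
  rw [weight, Real.rpow_sub hK, Real.rpow_add (by positivity), Real.rpow_two, Real.rpow_two]
  field_simp

variable [FiniteDimensional ℝ V] [FiniteDimensional ℝ Z]

/-- Along an orbit of the flow, a test function restricts to a compactly supported function of time,
because `log K` increases at unit speed. -/
theorem IsHType.hasCompactSupport_comp_flow (hL : L.IsHType) {φ : L.Grp → ℝ}
    (hφ : L.IsTestFunction φ) {p : V × Z} (hp : p.1 ≠ 0) :
    HasCompactSupport fun t => φ (L.coord (L.flow t p)) := by
  obtain ⟨-, hc, h1⟩ := hφ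
  have hpos : ∀ x ∈ tsupport φ, L.K x ≠ 0 := fun x hx =>
    (L.K_pos fun h => h1 (h ▸ hx)).ne'
  have hC : IsCompact ((fun x => Real.log (L.K x)) '' tsupport φ) :=
    IsCompact.image_of_continuousOn hc (L.continuous_K.continuousOn.log hpos)
  have hKp := L.K_pos (ne_one_of_fst_ne_zero (L := L) hp)
  refine HasCompactSupport.of_support_subset_isCompact
    ((Homeomorph.addRight (Real.log (L.K (L.coord p)))).isCompact_preimage.2 hC) fun t ht => ?_
  refine ⟨L.coord (L.flow t p), subset_tsupport _ ht, ?_⟩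
  simp only [hL.K_flow, Homeomorph.coe_addRight]
  rw [Real.log_mul (Real.exp_pos t).ne' hKp.ne', Real.log_exp]

theorem IsHType.deriv_comp_flow (hL : L.IsHType) {φ : L.Grp → ℝ} (hφ : Differentiable ℝ φ)
    {p : V × Z} (hp : p.1 ≠ 0) (t : ℝ) :
    deriv (fun t => φ (L.coord (L.flow t p))) t
      = fderiv ℝ φ (L.coord (L.flow t p)) (L.coord (L.flowField (L.flow t p))) := by
  have h1 := L.coord.hasFDerivAt.comp_hasDerivAt t (hL.hasDerivAt_flow hp t)
  exact ((hφ _).hasFDerivAt.comp_hasDerivAt t h1).deriv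

end

variable {V Z : Type*} [NormedAddCommGroup V] [InnerProductSpace ℝ V] [FiniteDimensional ℝ V]
  [NormedAddCommGroup Z] [InnerProductSpace ℝ Z] [FiniteDimensional ℝ Z] {L : TwoStepAlgebra V Z}
  [MeasurableSpace V] [BorelSpace V] [MeasurableSpace Z] [BorelSpace Z]

theorem IsHType.lintegral_hardy_eq (hL : L.IsHType) {m : ℕ} (b : OrthonormalBasis (Fin m) ℝ V)
    (α γ : ℝ) (φ : L.Grp → ℝ) :
    ∫⁻ p : V × Z, ENNReal.ofReal (L.K (L.exp p.1 p.2) ^ (α - 2) *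
        ‖L.hGrad b L.K (L.exp p.1 p.2)‖ ^ (γ + 2) * φ (L.exp p.1 p.2) ^ 2)
      = ∫⁻ p : V × Z, ENNReal.ofReal (L.weight α γ p * φ (L.coord p) ^ 2) := by
  refine lintegral_congr_ae ?_
  filter_upwards [L.ae_fst_ne_zero] with p hp
  change ENNReal.ofReal (L.K (L.coord p) ^ (α - 2) * ‖L.hGrad b L.K (L.coord p)‖ ^ (γ + 2) *
    φ (L.coord p) ^ 2) = _
  rw [hL.norm_hGrad_K b (ne_one_of_fst_ne_zero hp)]
  rfl

theorem IsHType.lintegral_radial_deriv_le (hL : L.IsHType) {m : ℕ}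
    (b : OrthonormalBasis (Fin m) ℝ V) (α γ : ℝ) {φ : L.Grp → ℝ} (hφ : Differentiable ℝ φ) :
    ∫⁻ p : V × Z, ENNReal.ofReal (L.weight α γ p *
        fderiv ℝ φ (L.coord p) (L.coord (L.flowField p)) ^ 2)
      ≤ ∫⁻ p : V × Z, ENNReal.ofReal (L.K (L.exp p.1 p.2) ^ α *
        ‖L.hGrad b L.K (L.exp p.1 p.2)‖ ^ γ * ‖L.hGrad b φ (L.exp p.1 p.2)‖ ^ 2) := by
  refine lintegral_mono_ae ?_
  filter_upwards [L.ae_fst_ne_zero] with p hp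
  have h := hL.norm_mul_abs_fderiv_flowField_le b (hφ (L.exp p.1 p.2)) hp
  have hK := L.K_pos (ne_one_of_fst_ne_zero (L := L) hp)
  have hN := hL.norm_hGrad_K b (ne_one_of_fst_ne_zero (L := L) hp)
  simp only [← coord_apply] at h ⊢
  change _ = ‖p.1‖ / _ at hN
  refine ENNReal.ofReal_le_ofReal ?_
  rw [hN, weight_eq α γ hp, mul_assoc]
  refine mul_le_mul_of_nonneg_left ?_ (by positivity)
  rw [← mul_pow, ← sq_abs, abs_mul, abs_of_nonneg (by positivity)]
  refine pow_le_pow_left₀ (by positivity) ?_ 2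
  rw [div_mul_eq_mul_div, div_le_iff₀ (by positivity)]
  linarith

/-- The Hardy inequality for the radial field `R`: on each orbit of its flow it is the
one-dimensional inequality. -/
theorem IsHType.lintegral_weight_mul_sq_le (hL : L.IsHType) {a : ℝ} (α γ : ℝ)
    (ha : a = (Module.finrank ℝ V + 2 * Module.finrank ℝ Z) + α - 2)
    {φ : L.Grp → ℝ} (hφ : L.IsTestFunction φ) :
    ENNReal.ofReal ((a / 2) ^ 2) *
        ∫⁻ p : V × Z, ENNReal.ofReal (L.weight α γ p * φ (L.coord p) ^ 2)
      ≤ ∫⁻ p : V × Z, ENNReal.ofReal (L.weight α γ p *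
        fderiv ℝ φ (L.coord p) (L.coord (L.flowField p)) ^ 2) := by
  have hw := measurable_weight (L := L) α γ
  have hd : Differentiable ℝ φ := hφ.1.differentiable (by norm_num)
  have m1 : Measurable fun p : V × Z => ENNReal.ofReal (L.weight α γ p * φ (L.coord p) ^ 2) := by
    have : Measurable fun p : V × Z => φ (L.coord p) :=
      (hφ.1.continuous.comp L.coord.continuous).measurable
    exact (hw.mul (this.pow_const 2)).ennreal_ofReal
  have m2 : Measurable fun p : V × Z => ENNReal.ofReal (L.weight α γ p *
      fderiv ℝ φ (L.coord p) (L.coord (L.flowField p)) ^ 2) := by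
    have hc : Continuous fun q : (V × Z) × (V × Z) => fderiv ℝ φ (L.coord q.1) (L.coord q.2) :=
      (((hφ.1.continuous_fderiv (by norm_num)).comp L.coord.continuous).comp
        continuous_fst).clm_apply (L.coord.continuous.comp continuous_snd)
    have hJ : Continuous fun p : V × Z => L.J p.2 p.1 := L.continuous_J continuous_snd continuous_fst
    have hR : Measurable (L.flowField) := by
      unfold flowField
      have hJm := hJ.measurable
      have h4 : Measurable fun p : V × Z => 4 / ‖p.1‖ ^ 2 := by fun_prop
      exact (measurable_fst.add (h4.smul hJm)).prodMk (measurable_snd.const_smul _)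
    have := hc.measurable.comp (measurable_id.prodMk hR)
    exact (hw.mul (this.pow_const 2)).ennreal_ofReal
  rw [hL.lintegral_eq_lintegral_orbits m1, hL.lintegral_eq_lintegral_orbits m2,
    ← lintegral_const_mul' _ _ ENNReal.ofReal_ne_top]
  refine lintegral_mono_ae ?_
  filter_upwards [L.ae_fst_ne_zero] with p hp
  rw [mul_left_comm]
  gcongr
  simp_rw [hL.exp_mul_weight_flow ha, ← hL.deriv_comp_flow hd hp]
  refine lintegral_exp_mul_sq_le (f := fun t => φ (L.coord (L.flow t p))) ?_
    (hL.hasCompactSupport_comp_flow hφ hp) a (weight_nonneg α γ p)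
  exact (hφ.1.comp (L.coord.contDiff.comp (contDiff_flow p))).of_le (by norm_num)

end TwoStepAlgebra

/-! ### Radial test functions and sharpness -/

theorem setLIntegral_ball_norm_rpow_lt_top {E : Type*} [NormedAddCommGroup E] [NormedSpace ℝ E]
    [FiniteDimensional ℝ E] [Nontrivial E] [MeasurableSpace E] [BorelSpace E] (μ : Measure E)
    [μ.IsAddHaarMeasure] {s r : ℝ} (hs : -(Module.finrank ℝ E : ℝ) < s) (hr : 0 < r) :
    ∫⁻ x in Metric.ball (0 : E) r, ENNReal.ofReal (‖x‖ ^ s) ∂μ < ⊤ := by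
  have h : IntegrableOn (fun x : E => ‖x‖ ^ s) (Metric.ball 0 r) μ := by
    rw [integrableOn_fun_norm_addHaar μ (f := fun y => y ^ s)]
    have h1 : IntegrableOn (fun y : ℝ => y ^ ((Module.finrank ℝ E - 1 : ℕ) + s)) (Set.Ioo 0 r) := by
      rw [intervalIntegral.integrableOn_Ioo_rpow_iff hr, Nat.cast_pred Module.finrank_pos]
      linarith
    refine h1.congr_fun (fun y hy => ?_) measurableSet_Ioo
    simp only [smul_eq_mul]
    rw [Real.rpow_add hy.1, Real.rpow_natCast]
  refine lt_of_eq_of_lt (lintegral_congr fun x => ?_) h.2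
  rw [Real.enorm_eq_ofReal (by positivity)]

namespace TwoStepAlgebra

section

variable {V Z : Type*} [NormedAddCommGroup V] [InnerProductSpace ℝ V]
  [NormedAddCommGroup Z] [InnerProductSpace ℝ Z] {L : TwoStepAlgebra V Z}

open scoped Classical in
/-- The radial function `f (log K)`, set to zero at the identity, where `Real.log` has a junk
value. -/
noncomputable def radial (L : TwoStepAlgebra V Z) (f : ℝ → ℝ) (x : L.Grp) : ℝ :=
  if x = 1 then 0 else f (Real.log (L.K x))

theorem radial_of_ne (f : ℝ → ℝ) {x : L.Grp} (hx : x ≠ 1) :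
    L.radial f x = f (Real.log (L.K x)) := if_neg hx

theorem radial_eventuallyEq (f : ℝ → ℝ) {x : L.Grp} (hx : x ≠ 1) :
    L.radial f =ᶠ[nhds x] fun y => f (Real.log (L.K y)) := by
  filter_upwards [isOpen_compl_singleton.mem_nhds hx] with y hy
  exact radial_of_ne f hy

theorem isTestFunction_radial [FiniteDimensional ℝ V] [FiniteDimensional ℝ Z]
    {f : ℝ → ℝ} (hf : ContDiff ℝ ∞ f) (hc : HasCompactSupport f) :
    L.IsTestFunction (L.radial f) := by
  obtain ⟨M, hM⟩ := hc.isCompact.isBounded.exists_norm_le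
  have hM' : ∀ x : L.Grp, L.radial f x ≠ 0 →
      Real.exp (-M) ≤ L.K x ∧ L.K x ≤ Real.exp M := fun x hx => by
    have hx1 : x ≠ 1 := fun h => hx (if_pos h)
    rw [radial_of_ne f hx1] at hx
    have h := abs_le.1 (hM _ (subset_tsupport f hx))
    rwa [Real.le_log_iff_exp_le (L.K_pos hx1), Real.log_le_iff_le_exp (L.K_pos hx1)] at h
  have h0 : L.radial f =ᶠ[nhds 1] 0 := by
    have : ∀ᶠ x in nhds (1 : L.Grp), L.K x < Real.exp (-M) := by
      refine L.continuous_K.continuousAt.eventually (Iio_mem_nhds ?_)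
      rw [K_one]
      exact Real.exp_pos _
    filter_upwards [this] with x hx
    by_contra h
    exact absurd (hM' x h).1 (not_le.2 hx)
  refine ⟨contDiff_iff_contDiffAt.2 fun x => ?_, ?_, notMem_tsupport_iff_eventuallyEq.2 h0⟩
  · rcases eq_or_ne x 1 with rfl | hx
    · exact contDiffAt_const.congr_of_eventuallyEq h0
    · refine ContDiffAt.congr_of_eventuallyEq ?_ (radial_eventuallyEq f hx)
      exact hf.contDiffAt.comp x ((L.contDiffAt_K hx).log (L.K_pos hx).ne')
  · refine HasCompactSupport.of_support_subset_isCompact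
      (((isCompact_closedBall (0 : V) (Real.exp M)).prod
        (isCompact_closedBall (0 : Z) (Real.exp M ^ 2))).image L.coord.continuous) fun x hx => ?_
    have hK := (hM' x hx).2
    have hx' : L.coord (L.coord.symm x) = x := L.coord.apply_symm_apply x
    refine ⟨L.coord.symm x, ⟨?_, ?_⟩, hx'⟩
    · rw [mem_closedBall_zero_iff]
      exact (norm_fst_le_K (L := L) _).trans (by rwa [hx'])
    · rw [mem_closedBall_zero_iff]
      refine (norm_snd_le_K_sq (L := L) _).trans ?_
      rw [hx']
      exact pow_le_pow_left₀ (L.K_nonneg x) hK 2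

end

variable {V Z : Type*} [NormedAddCommGroup V] [InnerProductSpace ℝ V] [FiniteDimensional ℝ V]
  [NormedAddCommGroup Z] [InnerProductSpace ℝ Z] [FiniteDimensional ℝ Z] {L : TwoStepAlgebra V Z}
  [MeasurableSpace V] [BorelSpace V] [MeasurableSpace Z] [BorelSpace Z]

/-- The mass of the `K`-homogeneous weight on the shell `1 ≤ K < e`, which is the angular factor of
integrals of radial functions. -/
noncomputable def angularMass (L : TwoStepAlgebra V Z) (a α γ : ℝ) : ℝ≥0∞ :=
  ∫⁻ p : V × Z, shell (L.K (L.coord p)) *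
    ENNReal.ofReal (L.weight α γ p * L.K (L.coord p) ^ (-a))

theorem measurable_angularMass_integrand {V Z : Type*} [NormedAddCommGroup V]
    [InnerProductSpace ℝ V] [NormedAddCommGroup Z] [InnerProductSpace ℝ Z] [FiniteDimensional ℝ Z]
    {L : TwoStepAlgebra V Z} [MeasurableSpace V] [BorelSpace V] [MeasurableSpace Z] [BorelSpace Z]
    (a α γ : ℝ) :
    Measurable fun p : V × Z => shell (L.K (L.coord p)) *
      ENNReal.ofReal (L.weight α γ p * L.K (L.coord p) ^ (-a)) := by
  have hw := measurable_weight (L := L) α γ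
  have hK : Measurable fun p : V × Z => L.K (L.coord p) :=
    (L.continuous_K.comp L.coord.continuous).measurable
  exact (measurable_shell.comp hK).mul (hw.mul (hK.pow_const _)).ennreal_ofReal

/-- Polar coordinates for `K`-radial functions against the weight. -/
theorem IsHType.lintegral_weight_mul_radial (hL : L.IsHType) {a α γ : ℝ}
    (ha : a = (Module.finrank ℝ V + 2 * Module.finrank ℝ Z) + α - 2) {q : ℝ → ℝ}
    (hq : Continuous q) :
    ∫⁻ p : V × Z, ENNReal.ofReal (L.weight α γ p * q (Real.log (L.K (L.coord p))))
      = L.angularMass a α γ * ∫⁻ t, ENNReal.ofReal (Real.exp (a * t) * q t) := by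
  have hw := measurable_weight (L := L) α γ
  have hK : Measurable fun p : V × Z => L.K (L.coord p) :=
    (L.continuous_K.comp L.coord.continuous).measurable
  have m1 : Measurable fun p : V × Z =>
      ENNReal.ofReal (L.weight α γ p * q (Real.log (L.K (L.coord p)))) :=
    (hw.mul (hq.measurable.comp hK.log)).ennreal_ofReal
  rw [hL.lintegral_eq_lintegral_orbits m1, angularMass,
    ← lintegral_mul_const _ (measurable_angularMass_integrand a α γ)]
  refine lintegral_congr_ae ?_
  filter_upwards [L.ae_fst_ne_zero] with p hp
  have hKp := L.K_pos (ne_one_of_fst_ne_zero (L := L) hp)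
  rw [mul_assoc]
  congr 1
  -- shift time so that the orbit crosses `K = 1` at time zero
  rw [← lintegral_add_right_eq_self (fun t => ENNReal.ofReal (Real.exp (a * t) * q t))
      (Real.log (L.K (L.coord p))),
    ← lintegral_const_mul' _ _ ENNReal.ofReal_ne_top]
  refine lintegral_congr fun t => ?_
  rw [hL.exp_mul_weight_flow ha, hL.K_flow, Real.log_mul (Real.exp_pos t).ne' hKp.ne',
    Real.log_exp, ← ENNReal.ofReal_mul
      (mul_nonneg (weight_nonneg α γ p) (Real.rpow_nonneg hKp.le _))]
  congr 1
  have : Real.exp (a * t) = L.K (L.coord p) ^ (-a) * Real.exp (a * (t + Real.log (L.K (L.coord p))))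
      := by
    rw [Real.rpow_def_of_pos hKp, ← Real.exp_add]
    congr 1
    ring
  rw [this]
  ring

theorem angularMass_ne_zero (a α γ : ℝ) : L.angularMass a α γ ≠ 0 := by
  have := L.nontrivial_fst
  rw [angularMass, Ne, lintegral_eq_zero_iff (measurable_angularMass_integrand a α γ)]
  intro h
  have hK : Continuous fun p : V × Z => L.K (L.coord p) := L.continuous_K.comp L.coord.continuous
  let U : Set (V × Z) := {p | p.1 ≠ 0} ∩ (fun p => L.K (L.coord p)) ⁻¹' Set.Ioo 1 (Real.exp 1)
  have hU : IsOpen U := (isOpen_ne_fun continuous_fst continuous_const).inter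
    (isOpen_Ioo.preimage hK)
  have hne : U.Nonempty := by
    -- `K (v, 0) = ‖v‖` and `1 < 2 < e`
    obtain ⟨v, hv⟩ := exists_norm_eq V (c := 2) (by norm_num)
    refine ⟨(v, 0), norm_ne_zero_iff.1 (by rw [hv]; norm_num), ?_⟩
    have h4 := L.K_pow_four (L.coord (v, 0))
    change _ = ‖v‖ ^ 4 + 16 * ‖(0 : Z)‖ ^ 2 at h4
    rw [hv, norm_zero, zero_pow two_ne_zero, mul_zero, add_zero,
      pow_left_inj₀ (L.K_nonneg _) (by norm_num) (by norm_num)] at h4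
    change L.K (L.coord (v, 0)) ∈ Set.Ioo 1 (Real.exp 1)
    rw [h4]
    exact ⟨by norm_num, by linarith [Real.exp_one_gt_d9]⟩
  have hpos := hU.measure_pos volume hne
  refine hpos.ne' (measure_mono_null (fun p hp => ?_) (ae_iff.1 h))
  obtain ⟨hp1, hp2⟩ := hp
  have hKp := L.K_pos (ne_one_of_fst_ne_zero (L := L) hp1)
  have hv : 0 < ‖p.1‖ := norm_pos_iff.2 hp1
  have hs : shell (L.K (L.coord p)) = 1 := Set.indicator_of_mem (Set.Ioo_subset_Ico_self hp2) 1
  have hw : 0 < L.weight α γ p * L.K (L.coord p) ^ (-a) := by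
    unfold weight
    positivity
  simp only [Set.mem_ofPred_eq, hs, one_mul, Pi.zero_apply, ENNReal.ofReal_eq_zero, not_le]
  exact hw

/-- The weight is integrable near `{v = 0}` because `γ + 2 > -m`; on the shell the powers
of `K` are bounded. -/
theorem angularMass_ne_top (a α : ℝ) {γ : ℝ} (hγ : -(Module.finrank ℝ V : ℝ) < γ + 2) :
    L.angularMass a α γ ≠ ⊤ := by
  have := L.nontrivial_fst
  let s : ℝ := α - 2 - (γ + 2) - a
  let G : V → ℝ≥0∞ :=
    (Metric.ball 0 (Real.exp 1)).indicator fun v => ENNReal.ofReal (‖v‖ ^ (γ + 2))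
  let H : Z → ℝ≥0∞ := (Metric.ball 0 (Real.exp 1 ^ 2)).indicator 1
  have hG : Measurable G := by
    refine Measurable.indicator ?_ Metric.isOpen_ball.measurableSet
    fun_prop
  have hH : Measurable H := measurable_one.indicator Metric.isOpen_ball.measurableSet
  have hle : L.angularMass a α γ
      ≤ ∫⁻ p : V × Z, ENNReal.ofReal (Real.exp |s|) * (G p.1 * H p.2) := by
    refine lintegral_mono_ae ?_
    filter_upwards [L.ae_fst_ne_zero] with p hp
    have hKp := L.K_pos (ne_one_of_fst_ne_zero (L := L) hp)
    have hv : 0 < ‖p.1‖ := norm_pos_iff.2 hp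
    by_cases hp2 : L.K (L.coord p) ∈ Set.Ico 1 (Real.exp 1)
    · have hs : shell (L.K (L.coord p)) = 1 := Set.indicator_of_mem hp2 1
      have hG1 : G p.1 = ENNReal.ofReal (‖p.1‖ ^ (γ + 2)) := by
        refine Set.indicator_of_mem ?_ _
        rw [mem_ball_zero_iff]
        exact (norm_fst_le_K p).trans_lt hp2.2
      have hH1 : H p.2 = 1 := by
        refine Set.indicator_of_mem ?_ _
        rw [mem_ball_zero_iff]
        exact (norm_snd_le_K_sq p).trans_lt (pow_lt_pow_left₀ hp2.2 hKp.le two_ne_zero)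
      rw [hs, hG1, hH1, one_mul, mul_one, ← ENNReal.ofReal_mul (Real.exp_pos _).le]
      refine ENNReal.ofReal_le_ofReal ?_
      have e : L.weight α γ p * L.K (L.coord p) ^ (-a)
          = L.K (L.coord p) ^ s * ‖p.1‖ ^ (γ + 2) := by
        simp only [s]
        rw [weight, Real.div_rpow hv.le hKp.le, Real.rpow_sub hKp _ a, Real.rpow_sub hKp _ (γ + 2),
          Real.rpow_neg hKp.le]
        ring
      rw [e]
      gcongr
      rw [Real.rpow_def_of_pos hKp, Real.exp_le_exp]
      have l0 : 0 ≤ Real.log (L.K (L.coord p)) := Real.log_nonneg hp2.1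
      have l1 : Real.log (L.K (L.coord p)) ≤ 1 :=
        (Real.log_le_iff_le_exp hKp).2 hp2.2.le
      calc Real.log (L.K (L.coord p)) * s ≤ Real.log (L.K (L.coord p)) * |s| := by
            gcongr; exact le_abs_self s
        _ ≤ 1 * |s| := by gcongr
        _ = |s| := one_mul _
    · have hs : shell (L.K (L.coord p)) = 0 := Set.indicator_of_notMem hp2 1
      rw [hs, zero_mul]
      exact zero_le
  refine (hle.trans_lt ?_).ne
  rw [lintegral_const_mul' _ _ ENNReal.ofReal_ne_top, Measure.volume_eq_prod,
    lintegral_prod_mul hG.aemeasurable hH.aemeasurable]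
  refine ENNReal.mul_lt_top ENNReal.ofReal_lt_top (ENNReal.mul_lt_top ?_ ?_)
  · rw [lintegral_indicator Metric.isOpen_ball.measurableSet]
    exact setLIntegral_ball_norm_rpow_lt_top volume hγ (Real.exp_pos 1)
  · rw [lintegral_indicator_one Metric.isOpen_ball.measurableSet]
    exact measure_ball_lt_top

theorem IsHType.lintegral_grad_radial_eq (hL : L.IsHType) {m : ℕ}
    (b : OrthonormalBasis (Fin m) ℝ V) (α γ : ℝ) {f : ℝ → ℝ} (hf : Differentiable ℝ f) :
    ∫⁻ p : V × Z, ENNReal.ofReal (L.K (L.exp p.1 p.2) ^ α *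
        ‖L.hGrad b L.K (L.exp p.1 p.2)‖ ^ γ * ‖L.hGrad b (L.radial f) (L.exp p.1 p.2)‖ ^ 2)
      = ∫⁻ p : V × Z, ENNReal.ofReal
          (L.weight α γ p * deriv f (Real.log (L.K (L.coord p))) ^ 2) := by
  refine lintegral_congr_ae ?_
  filter_upwards [L.ae_fst_ne_zero] with p hp
  have hp1 := ne_one_of_fst_ne_zero (L := L) hp
  have hK := L.K_pos hp1
  have hN := hL.norm_hGrad_K b hp1
  have hd : HasDerivAt (fun r => f (Real.log r)) _ (L.K (L.coord p)) :=
    (hf (Real.log (L.K (L.coord p)))).hasDerivAt.comp _ (Real.hasDerivAt_log hK.ne')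
  have hR := hL.norm_hGrad_comp_K b hp1 (radial_eventuallyEq f hp1) hd
  simp only [← coord_apply]
  rw [hR, hN, weight_eq α γ hp]
  change ENNReal.ofReal (_ * (‖p.1‖ / _) ^ γ * (_ * (‖p.1‖ / _)) ^ 2) = _
  rw [mul_assoc _ _ (deriv f _ ^ 2), mul_pow, sq_abs]
  congr 2
  field_simp

end TwoStepAlgebra

theorem theorem3p3 {V Z : Type*} [NormedAddCommGroup V] [InnerProductSpace ℝ V]
    [FiniteDimensional ℝ V] [NormedAddCommGroup Z] [InnerProductSpace ℝ Z]
    [FiniteDimensional ℝ Z] (L : TwoStepAlgebra V Z) (hL : L.IsHType)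
    (m k : ℕ) (hk : k = Module.finrank ℝ Z) (b : OrthonormalBasis (Fin m) ℝ V)
    (μ : Measure L.Grp) [μ.IsHaarMeasure]
    (Q : ℝ) (hQ : Q = m + 2 * k) (α γ : ℝ) :
    (∀ φ : L.Grp → ℝ, L.IsTestFunction φ →
      ENNReal.ofReal (((Q + α - 2) / 2) ^ 2) * L.hardyIntegral b μ α γ φ
        ≤ L.gradIntegral b μ α γ φ) ∧
    (0 < Q + α - 2 → -(m + 2 : ℝ) < γ → ∀ C : ℝ, ((Q + α - 2) / 2) ^ 2 < C →
      ∃ φ : L.Grp → ℝ, L.IsTestFunction φ ∧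
        L.gradIntegral b μ α γ φ < ENNReal.ofReal C * L.hardyIntegral b μ α γ φ) := by
  borelize V Z
  obtain ⟨c, hc0, hctop, hc⟩ := L.exists_lintegral_haar_eq μ
  have hm : Module.finrank ℝ V = m := by
    rw [Module.finrank_eq_card_basis b.toBasis, Fintype.card_fin]
  have ha : Q + α - 2 = (Module.finrank ℝ V + 2 * Module.finrank ℝ Z) + α - 2 := by
    rw [hQ, hm, hk]
  constructor
  · intro φ hφ
    rw [TwoStepAlgebra.hardyIntegral, TwoStepAlgebra.gradIntegral, hc, hc, mul_left_comm,
      hL.lintegral_hardy_eq b]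
    gcongr
    exact (hL.lintegral_weight_mul_sq_le α γ ha hφ).trans
      (hL.lintegral_radial_deriv_le b α γ (hφ.1.differentiable (by norm_num)))
  · intro _ hγ C hC
    obtain ⟨f, hf, hfc, hlt⟩ := exists_integral_exp_mul_deriv_sq_lt (Q + α - 2) C hC
    refine ⟨L.radial f, TwoStepAlgebra.isTestFunction_radial hf hfc, ?_⟩
    have hA0 := TwoStepAlgebra.angularMass_ne_zero (L := L) (Q + α - 2) α γ
    have hA := TwoStepAlgebra.angularMass_ne_top (L := L) (Q + α - 2) α (γ := γ)
      (by rw [hm]; linarith)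
    have hrad : ∫⁻ p : V × Z, ENNReal.ofReal (L.weight α γ p * L.radial f (L.coord p) ^ 2)
        = ∫⁻ p : V × Z, ENNReal.ofReal
          (L.weight α γ p * f (Real.log (L.K (L.coord p))) ^ 2) := by
      refine lintegral_congr_ae ?_
      filter_upwards [L.ae_fst_ne_zero] with p hp
      rw [TwoStepAlgebra.radial_of_ne f (TwoStepAlgebra.ne_one_of_fst_ne_zero hp)]
    have hf' : Continuous (deriv f) := hf.continuous_deriv (by norm_num)
    have I0 := lintegral_const_mul_exp_mul_sq hf.continuous hfc (Q + α - 2) zero_le_one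
    have I1 := lintegral_const_mul_exp_mul_sq hf' hfc.deriv (Q + α - 2) zero_le_one
    simp only [one_mul] at I0 I1
    rw [TwoStepAlgebra.hardyIntegral, TwoStepAlgebra.gradIntegral, hc, hc,
      hL.lintegral_hardy_eq b, hrad,
      hL.lintegral_grad_radial_eq b α γ (hf.differentiable (by norm_num)),
      hL.lintegral_weight_mul_radial ha (q := fun s => f s ^ 2) (hf.continuous.pow 2),
      hL.lintegral_weight_mul_radial ha (q := fun s => deriv f s ^ 2) (hf'.pow 2), I0, I1,
      ← mul_assoc c, ← mul_assoc c, mul_left_comm, ← ENNReal.ofReal_mul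
        ((sq_nonneg _).trans hC.le)]
    refine ENNReal.mul_lt_mul_right (mul_ne_zero hc0 hA0) (ENNReal.mul_ne_top hctop hA) ?_
    have hnn : 0 ≤ ∫ t, Real.exp ((Q + α - 2) * t) * deriv f t ^ 2 :=
      integral_nonneg fun t => by positivity
    exact (ENNReal.ofReal_lt_ofReal_iff_of_nonneg hnn).2 hlt
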